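/- Let $b\ge 2$, $m\ge 1$ be integers with $b\not\equiv 1 \pmod m$, let $q$ be the smallest positive integer with $q(b-1)\equiv 0\pmod m$, and let $\mathbf t=\mathbf t_{b,m}$ be the generalized Thue-Morse word over $\mathbb Z_m$, i.e. the fixed point starting in $0$ of the morphism $k\mapsto k(k+1)\cdots(k+b-1)$ (letters modulo $m$). Write $\mathcal L_n$ for the set of factors of $\mathbf t$ of length $n$, $\mathcal L=\bigcup_n\mathcal L_n$, and $\mathcal C(n)=\#\mathcal L_n$. The frequency of a factor $w$ is $$\rho(w)=\lim_{|v|\to\infty,\ v\in\mathcal L}\frac{\#\{\text{occurrences of } w \text{ in } v\}}{|v|}.$$ A factor $w$ is bispecial if there are at least two letters $a$ with $aw\in\mathcal L$ and at least two letters $a$ with $wa\in\mathcal L$. Call a finite group $G$ (under composition) of morphisms and antimorphisms of the free monoid $\mathbb Z_m^*$ admissible if it contains an antimorphism and $\mathcal L$ is invariant under all its elements. For such $G$ put $$B_G(n)=\frac1{\#G}\Bigl(4\bigl(\mathcal C(n+1)-\mathcal C(n)\bigr)+\#G-X-Y\Bigr),$$ where $X$ is the number of bispecial factors of length $n$ and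 $Y$ is the number of bispecial factors $w$ of length $n$ with $\theta(w)=w$ for some antimorphism $\theta\in G$. (For a uniformly recurrent aperiodic word with such a symmetry group whose factor frequencies exist, $B_G(n)$ is the general upper bound, valid for all large $n$, on the number of frequencies of factors of length $n+1$.) Then all factors of $\mathbf t$ have a frequency; the group $D_m$ consisting of the morphisms with $k\mapsto x+k$ and the antimorphisms with $k\mapsto x-k$ $(x\in\mathbb Z_m)$ is admissible; and the following holds. 1. For every admissible $G$, it is not the case that the bound is attained for all large $n$: for every $M\in\mathbb N$ there is $n\ge M$ with $\#\{\rho(e)\mid e\in\mathcal L_{n+1}\}<B_G(n)$. 2. If $q>2$, the bound is never attained: for every admissible $G$ and every $n\in\mathbb N$, $\#\{\rho(e)\mid e\in\mathcal L_{n+1}\}<B_G(n)$. 3. If $q=2$, then for every integer $\ell\ge0$ and $n=(2b-1)b^\ell$, one has $B_{D_m}(n)=4$, while $\#\{\rho(e)\mid e\in\mathcal L_{n+1}\}$ equals $3$ if $b\ne2$, and equals $2$ if $b=2$ (that is, for the classical Thue-Morse word $\mathbf t_{2,2}$). -/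

import Mathlib

open Filter Topology

namespace FactorFrequency

section Words

variable {A : Type*}

/-- The word `u i, u (i+1), …, u (i+n-1)` occurring in the infinite word `u` at position `i`. -/
def factorAt (u : ℕ → A) (i n : ℕ) : List A := (List.range n).map fun j => u (i + j)

/-- The language of `u`: the set of all its (finite, possibly empty) factors. -/
def language (u : ℕ → A) : Set (List A) := {w | ∃ i n, w = factorAt u i n}

/-- The factors of `u` of length `n`. -/
def factors (u : ℕ → A) (n : ℕ) : Set (List A) := {w | w ∈ language u ∧ w.length = n}

/-- Factor complexity: the number of factors of `u` of length `n`. -/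
noncomputable def complexity (u : ℕ → A) (n : ℕ) : ℕ := (factors u n).ncard

/-- Number of occurrences of the word `w` in the word `v`. -/
def occurrences [DecidableEq A] (w v : List A) : ℕ :=
  ((Finset.range (v.length + 1)).filter fun i => w <+: v.drop i).card

/-- `w` has frequency `r` in `u`: the ratio `#{occurrences of w in v} / |v|` tends to `r` as
`|v| → ∞`, where `v` runs through the factors of `u`. -/
def HasFrequency [DecidableEq A] (u : ℕ → A) (w : List A) (r : ℝ) : Prop :=
  Tendsto (fun v : List A => (occurrences w v : ℝ) / (v.length : ℝ))
    (comap List.length atTop ⊓ 𝓟 (language u)) (𝓝 r)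

/-- The set of the frequencies of the factors of `u` of length `n`. -/
def frequencies [DecidableEq A] (u : ℕ → A) (n : ℕ) : Set ℝ :=
  {r | ∃ e ∈ factors u n, HasFrequency u e r}

/-- Letters extending the word `w` to the left within the language of `u`. -/
def leftExtensions (u : ℕ → A) (w : List A) : Set A := {a | a :: w ∈ language u}

/-- Letters extending the word `w` to the right within the language of `u`. -/
def rightExtensions (u : ℕ → A) (w : List A) : Set A := {a | w ++ [a] ∈ language u}

/-- The bispecial factors of `u` of length `n`: those having at least two left extensions and at
least two right extensions. -/
def bispecialFactors (u : ℕ → A) (n : ℕ) : Set (List A) :=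
  {w | w ∈ factors u n ∧ (leftExtensions u w).Nontrivial ∧ (rightExtensions u w).Nontrivial}

/-- Morphisms of the free monoid of words. -/
def IsMorphism (g : List A → List A) : Prop := ∀ v w, g (v ++ w) = g v ++ g w

/-- Antimorphisms of the free monoid of words. -/
def IsAntimorphism (g : List A → List A) : Prop := ∀ v w, g (v ++ w) = g w ++ g v

/-- `G` is a finite group of morphisms and antimorphisms of the free monoid of words (the group
operation being composition), it contains an antimorphism, and the language of `u` is invariant
under all its elements. -/
structure IsSymmetryGroup (u : ℕ → A) (G : Subgroup (Equiv.Perm (List A))) : Prop where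
  finite : Finite G
  morphism_or_antimorphism : ∀ g ∈ G, IsMorphism g ∨ IsAntimorphism g
  exists_antimorphism : ∃ g ∈ G, IsAntimorphism g
  invariant : ∀ g ∈ G, ∀ w ∈ language u, g w ∈ language u

/-- Bispecial factors of `u` of length `n` that are `θ`-palindromes for an antimorphism
`θ ∈ G`. -/
def palindromicBispecialFactors (u : ℕ → A) (G : Subgroup (Equiv.Perm (List A))) (n : ℕ) :
    Set (List A) :=
  {w | w ∈ bispecialFactors u n ∧ ∃ θ ∈ G, IsAntimorphism θ ∧ θ w = w}

/-- The upper bound `(4 (C(n+1) - C(n)) + #G - X - Y) / #G` on the number of frequencies of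
factors of length `n + 1`, where `X` is the number of bispecial factors of length `n` and `Y` is
the number of those which are `θ`-palindromes for an antimorphism `θ ∈ G`. -/
noncomputable def frequencyBound (u : ℕ → A) (G : Subgroup (Equiv.Perm (List A))) (n : ℕ) : ℝ :=
  1 / (Nat.card G : ℝ) *
    (4 * ((complexity u (n + 1) : ℝ) - (complexity u n : ℝ)) + (Nat.card G : ℝ)
      - ((bispecialFactors u n).ncard : ℝ) - ((palindromicBispecialFactors u G n).ncard : ℝ))

/-- The infinite word `u` is a fixed point of the morphism given by the letter images `φ`: the
image of every prefix of `u` is a prefix of `u`. -/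
def IsFixedPoint (φ : A → List A) (u : ℕ → A) : Prop :=
  ∀ n, (factorAt u 0 n).flatMap φ = factorAt u 0 ((factorAt u 0 n).flatMap φ).length

end Words

/-- Letter images of the morphism `k ↦ k (k+1) … (k+b-1)` over the alphabet `ℤ/mℤ`. -/
def thueMorseMorphism (b m : ℕ) (k : ZMod m) : List (ZMod m) :=
  (List.range b).map fun j : ℕ => k + (j : ZMod m)

/-- `u` is the generalized Thue-Morse word with parameters `b` and `m`: the fixed point starting
in `0` of the morphism `k ↦ k (k+1) … (k+b-1)`. -/
def IsGeneralizedThueMorse (b m : ℕ) (u : ℕ → ZMod m) : Prop :=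
  u 0 = 0 ∧ IsFixedPoint (thueMorseMorphism b m) u

/-- The morphism `Π_x` with `Π_x(k) = x + k` for letters `k`. -/
def translation {m : ℕ} (x : ZMod m) : Equiv.Perm (List (ZMod m)) where
  toFun w := w.map fun k => x + k
  invFun w := w.map fun k => -x + k
  left_inv w := by simp
  right_inv w := by simp

/-- The antimorphism `Ψ_x` with `Ψ_x(k) = x - k` for letters `k`. -/
def reflection {m : ℕ} (x : ZMod m) : Equiv.Perm (List (ZMod m)) where
  toFun w := (w.map fun k => x - k).reverse
  invFun w := (w.map fun k => x - k).reverse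
  left_inv w := by simp
  right_inv w := by simp

/-- The group `D_m` of all `Π_x` and `Ψ_x`, `x ∈ ℤ/mℤ`. -/
def dihedral (m : ℕ) : Subgroup (Equiv.Perm (List (ZMod m))) where
  carrier := Set.range translation ∪ Set.range reflection
  one_mem' := Or.inl ⟨0, by ext1 w; simp [translation]⟩
  mul_mem' := by
    rintro _ _ (⟨x, rfl⟩ | ⟨x, rfl⟩) (⟨y, rfl⟩ | ⟨y, rfl⟩)
    · exact Or.inl ⟨x + y, by ext1 w; simp [translation, Function.comp_def, add_assoc]⟩
    · exact Or.inr ⟨x + y, by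
        ext1 w; simp [translation, reflection, Function.comp_def, add_sub_assoc]⟩
    · exact Or.inr ⟨x - y, by
        ext1 w; simp [translation, reflection, Function.comp_def, sub_sub]⟩
    · exact Or.inl ⟨x - y, by
        ext1 w; simp [translation, reflection, Function.comp_def, sub_add]⟩
  inv_mem' := by
    rintro _ (⟨x, rfl⟩ | ⟨x, rfl⟩)
    · exact Or.inl ⟨-x, by ext1 w; simp [translation, Equiv.Perm.inv_def, Equiv.symm]⟩
    · exact Or.inr ⟨x, by ext1 w; simp [reflection, Equiv.Perm.inv_def, Equiv.symm]⟩

theorem length_factorAt {A : Type*} (u : ℕ → A) (i n : ℕ) : (factorAt u i n).length = n := by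
  simp [factorAt]

theorem factorAt_add {A : Type*} (u : ℕ → A) (i n k : ℕ) :
    factorAt u i (n + k) = factorAt u i n ++ factorAt u (i + n) k := by
  simp [factorAt, List.range_add, Function.comp_def, add_assoc]

theorem length_flatMap_thueMorse (b m : ℕ) (w : List (ZMod m)) :
    (w.flatMap (thueMorseMorphism b m)).length = b * w.length := by
  induction w with
  | nil => simp
  | cons a w ih => simp [ih, thueMorseMorphism, Nat.mul_add, add_comm]

/-- Letterwise form of the fixed point equation. -/
theorem isFixedPoint_thueMorse_iff (b m : ℕ) (u : ℕ → ZMod m) :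
    IsFixedPoint (thueMorseMorphism b m) u ↔
      ∀ i, ∀ j < b, u (b * i + j) = u i + (j : ZMod m) := by
  have step : ∀ n, (factorAt u 0 (n + 1)).flatMap (thueMorseMorphism b m) =
      (factorAt u 0 n).flatMap (thueMorseMorphism b m) ++ thueMorseMorphism b m (u n) := by
    intro n
    rw [factorAt_add]
    simp [factorAt]
  have block : ∀ i, factorAt u (b * i) b = thueMorseMorphism b m (u i) ↔
      ∀ j < b, u (b * i + j) = u i + (j : ZMod m) := by
    intro i
    simp [factorAt, thueMorseMorphism]
  simp only [IsFixedPoint, length_flatMap_thueMorse, length_factorAt, ← block]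
  constructor
  · intro h i
    have h1 := h (i + 1)
    rw [step, h i, Nat.mul_add, mul_one, factorAt_add, List.append_cancel_left_eq, zero_add] at h1
    exact h1.symm
  · intro h n
    induction n with
    | zero => simp [factorAt]
    | succ n ih =>
      rw [step, ih, Nat.mul_add, mul_one, factorAt_add, zero_add, h]

/-- The generalized Thue-Morse word exists and is unique. -/
theorem existsUnique_generalizedThueMorse (b m : ℕ) (hb : 2 ≤ b) :
    ∃! u : ℕ → ZMod m, IsGeneralizedThueMorse b m u := by
  refine ⟨fun n => ((Nat.digits b n).sum : ZMod m), ⟨by simp, ?_⟩, ?_⟩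
  · rw [isFixedPoint_thueMorse_iff]
    intro i j hj
    rcases Nat.eq_zero_or_pos (b * i + j) with h0 | h0
    · have hj0 : j = 0 := by omega
      have hi0 : i = 0 := by
        have : b * i = 0 := by omega
        rcases Nat.mul_eq_zero.mp this with h | h
        · omega
        · exact h
      simp [hi0, hj0]
    · have h1 : (b * i + j) % b = j := by rw [Nat.mul_add_mod, Nat.mod_eq_of_lt hj]
      have h2 : (b * i + j) / b = i := by
        rw [Nat.mul_add_div (by omega), Nat.div_eq_of_lt hj, add_zero]
      rw [Nat.digits_def' (by omega) h0, h1, h2]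
      simp [add_comm]
  · rintro u ⟨hu0, hu⟩
    rw [isFixedPoint_thueMorse_iff] at hu
    funext n
    induction n using Nat.strong_induction_on with
    | _ n ih =>
      rcases Nat.eq_zero_or_pos n with rfl | hn
      · simp [hu0]
      · have h := hu (n / b) (n % b) (Nat.mod_lt _ (by omega))
        rw [Nat.div_add_mod, ih _ (Nat.div_lt_self hn (by omega))] at h
        rw [h, Nat.digits_def' (by omega) hn]
        simp [add_comm]

end FactorFrequency

open FactorFrequency

namespace FactorFrequency

/-! Successive letters of the Thue-Morse word `u` differ by $1-(b-1)\nu_b(i+1)$, with $\nu_b$ the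
exponent of $b$. So `u` is encoded by its letters and the ruler word `v` over $\mathbb Z_q$, whose
$i$-th letter is $\nu_b(i+1)$ mod $q$. Multiplication by $b-1$ embeds $\mathbb Z_q$ in $\mathbb
Z_m$, and every factor of `v` occurs below every starting letter. Hence length $n+1$ for `u`
corresponds to length $n$ for `v`: complexity and the number of bispecial factors are multiplied by
$m$, frequencies divided by $m$.

An admissible morphism permutes letters and preserves frequencies. Since $0$ is strictly the most
frequent letter of `v`, the pairs $a(a+1)$ go to pairs of the same form, so $G\le D_m$ and $\#G\le
2m$ (`le_dihedral`). With $Y\le X$ this yields $B_G(n+1)\ge 1+2\Delta(n)-X_v(n)$, where $\Delta$ is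
the complexity increment of `v` and $X_v$ its number of bispecial factors (`le_frequencyBound`).

The word `v` is fixed by $c\mapsto 0^{b-1}(c+1)$. A factor that is nonzero, or of length at least
$2b-1$, determines its position modulo $b$ (`residue_eq`); it has a unique preimage, and its
frequency is that of the preimage divided by $b$ (`density_expand`). Beyond length $2b-2$ everything
reduces from $n$ to $n/b$. For $q>2$ an induction gives strict inequality at every length
(`ncard_density_add_lt`); as preimages may have two consecutive lengths, it needs a companion
estimate for the union of two levels (`ncard_density_union_lt`).

For $q=2$ and $n=(2b-1)b^\ell$, the relevant increment is $2$ and there is one bispecial factor of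
`v`, a palindrome. So the bound is at least $4$ for every $G$ and equals $4$ for $D_m$, while the
frequencies are proportional to $b-1$, $1$ and $b$, the first two coinciding exactly when $b=2$. -/

/-! ### Uniform means of sequences -/

/-- The sum of `f` over the window `[i, i + n)`. -/
def windowSum (f : ℕ → ℝ) (i n : ℕ) : ℝ := ∑ k ∈ Finset.range n, f (i + k)

/-- Up to a bounded error, the mean of `f` over every window is within `ε` of `a`. -/
def NearMean (f : ℕ → ℝ) (a ε : ℝ) : Prop :=
  ∃ K : ℝ, ∀ i n : ℕ, |windowSum f i n - a * n| ≤ ε * n + K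

/-- `f` has uniform mean `a`. -/
def HasMean (f : ℕ → ℝ) (a : ℝ) : Prop := ∀ ε > 0, NearMean f a ε

theorem NearMean.mono {f : ℕ → ℝ} {a ε δ : ℝ} (h : NearMean f a ε) (hε : ε ≤ δ) :
    NearMean f a δ := by
  obtain ⟨K, hK⟩ := h
  refine ⟨K, fun i n => (hK i n).trans ?_⟩
  gcongr

theorem NearMean.abs_sub_le {f : ℕ → ℝ} {a a' ε ε' : ℝ} (h : NearMean f a ε)
    (h' : NearMean f a' ε') : |a - a'| ≤ ε + ε' := by
  obtain ⟨K, hK⟩ := h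
  obtain ⟨K', hK'⟩ := h'
  by_contra! hlt
  obtain ⟨n, hn⟩ := exists_nat_gt ((K + K') / (|a - a'| - (ε + ε')))
  rw [div_lt_iff₀ (by linarith)] at hn
  have h1 := hK 0 n
  have h2 := hK' 0 n
  rw [abs_le] at h1 h2
  rcases abs_cases (a - a') with ⟨e, -⟩ | ⟨e, -⟩ <;> rw [e] at hn <;> linarith

theorem HasMean.unique {f : ℕ → ℝ} {a a' : ℝ} (h : HasMean f a) (h' : HasMean f a') :
    a = a' := by
  by_contra hne
  have hpos : 0 < |a - a'| := abs_pos.mpr (sub_ne_zero.mpr hne)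
  have := (h (|a - a'| / 4) (by positivity)).abs_sub_le (h' (|a - a'| / 4) (by positivity))
  linarith

theorem windowSum_add (f g : ℕ → ℝ) (i n : ℕ) :
    windowSum (f + g) i n = windowSum f i n + windowSum g i n := by
  simp [windowSum, Finset.sum_add_distrib]

theorem windowSum_sum {ι : Type*} (s : Finset ι) (f : ι → ℕ → ℝ) (i n : ℕ) :
    windowSum (∑ j ∈ s, f j) i n = ∑ j ∈ s, windowSum (f j) i n := by
  simp only [windowSum, Finset.sum_apply]
  exact Finset.sum_comm

theorem HasMean.add {f g : ℕ → ℝ} {a c : ℝ} (hf : HasMean f a) (hg : HasMean g c) :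
    HasMean (f + g) (a + c) := by
  intro ε hε
  obtain ⟨K, hK⟩ := hf (ε / 2) (by positivity)
  obtain ⟨K', hK'⟩ := hg (ε / 2) (by positivity)
  refine ⟨K + K', fun i n => ?_⟩
  rw [windowSum_add]
  have h1 := hK i n
  have h2 := hK' i n
  rw [abs_le] at *
  constructor <;> linarith

theorem hasMean_zero : HasMean 0 0 := fun ε hε =>
  ⟨0, fun i n => by simp only [windowSum, Pi.zero_apply]; simp; positivity⟩

theorem hasMean_one : HasMean 1 1 := fun ε hε =>
  ⟨0, fun i n => by simp only [windowSum, Pi.one_apply]; simp; positivity⟩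

theorem HasMean.sum {ι : Type*} (s : Finset ι) {f : ι → ℕ → ℝ} {a : ι → ℝ}
    (h : ∀ j ∈ s, HasMean (f j) (a j)) : HasMean (∑ j ∈ s, f j) (∑ j ∈ s, a j) := by
  classical
  induction s using Finset.induction_on with
  | empty => simpa using hasMean_zero
  | insert j s hj ih =>
    rw [Finset.sum_insert hj, Finset.sum_insert hj]
    exact (h j (Finset.mem_insert_self _ _)).add
      (ih fun k hk => h k (Finset.mem_insert_of_mem hk))

/-- The approximate means are shared by the whole family; they form a Cauchy sequence, and its limit
is a mean common to all members. -/
theorem exists_hasMean_of_nearMean {ι : Type*} [Nonempty ι] {f : ι → ℕ → ℝ}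
    (h : ∀ ε > 0, ∃ a, ∀ x, NearMean (f x) a ε) : ∃ a, ∀ x, HasMean (f x) a := by
  choose a ha using fun k : ℕ => h (1 / ((k : ℝ) + 1)) (by positivity)
  obtain ⟨x₀⟩ := ‹Nonempty ι›
  have hlim := tendsto_one_div_add_atTop_nhds_zero_nat (𝕜 := ℝ)
  have hc : CauchySeq a := by
    rw [Metric.cauchySeq_iff']
    intro ε hε
    obtain ⟨N, hN⟩ := (hlim.eventually (gt_mem_nhds (half_pos hε))).exists_forall_of_atTop
    refine ⟨N, fun n hn => ?_⟩
    have := (ha n x₀).abs_sub_le (ha N x₀)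
    rw [Real.dist_eq]
    linarith [hN n hn, hN N le_rfl]
  obtain ⟨r, hr⟩ := cauchySeq_tendsto_of_complete hc
  refine ⟨r, fun x ε hε => ?_⟩
  obtain ⟨k, hk1, hk2⟩ := ((hlim.eventually (gt_mem_nhds (half_pos hε))).and
    (hr.eventually (Metric.ball_mem_nhds r (half_pos hε)))).exists
  obtain ⟨K, hK⟩ := ha k x
  refine ⟨K, fun i n => ?_⟩
  rw [Real.dist_eq] at hk2
  have h1 := hK i n
  have h2 : |(a k - r) * n| ≤ ε / 2 * n := by
    rw [abs_mul, abs_of_nonneg (Nat.cast_nonneg (α := ℝ) n)]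
    gcongr
  have h3 : 1 / ((k : ℝ) + 1) * n ≤ ε / 2 * n := by gcongr
  rw [abs_le] at *
  constructor <;> linarith

theorem windowSum_eq_sub (f : ℕ → ℝ) (i n : ℕ) :
    windowSum f i n = ∑ k ∈ Finset.range (i + n), f k - ∑ k ∈ Finset.range i, f k := by
  rw [Finset.sum_range_add]
  simp [windowSum]

theorem sum_range_mul_blocks (f : ℕ → ℝ) (B t : ℕ) :
    ∑ k ∈ Finset.range (B * t), f k =
      ∑ r ∈ Finset.range B, ∑ s ∈ Finset.range t, f (B * s + r) := by
  induction t with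
  | zero => simp
  | succ t ih =>
    rw [Nat.mul_succ, Finset.sum_range_add, ih, ← Finset.sum_add_distrib]
    exact Finset.sum_congr rfl fun r _ => (Finset.sum_range_succ _ _).symm

theorem windowSum_nonneg {f : ℕ → ℝ} (hf : ∀ k, 0 ≤ f k) (i n : ℕ) : 0 ≤ windowSum f i n :=
  Finset.sum_nonneg fun _ _ => hf _

theorem windowSum_le {f : ℕ → ℝ} (hf : ∀ k, f k ≤ 1) (i n : ℕ) : windowSum f i n ≤ n :=
  (Finset.sum_le_sum fun _ _ => hf _).trans (by simp)

/-- A window sum decomposes, up to a bounded error, along the residue classes modulo `B`. -/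
theorem abs_windowSum_sub_blocks_le {f : ℕ → ℝ} (h0 : ∀ k, 0 ≤ f k) (h1 : ∀ k, f k ≤ 1)
    {B : ℕ} (hB : 0 < B) (i n : ℕ) :
    |windowSum f i n - ∑ r ∈ Finset.range B,
      windowSum (fun t => f (B * t + r)) (i / B) ((i + n) / B - i / B)| ≤ B := by
  -- An initial segment is cut into whole blocks of length `B` and a remainder `e` in $[0,B]$. A
  -- window is a difference of two initial segments, so its error is a difference of two such
  -- remainders.
  have key : ∀ X, ∃ e, 0 ≤ e ∧ e ≤ (B : ℝ) ∧ ∑ k ∈ Finset.range X, f k =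
      (∑ r ∈ Finset.range B, ∑ s ∈ Finset.range (X / B), f (B * s + r)) + e := by
    intro X
    refine ⟨windowSum f (B * (X / B)) (X % B), windowSum_nonneg h0 _ _,
      (windowSum_le h1 _ _).trans (by exact_mod_cast (Nat.mod_lt _ hB).le), ?_⟩
    rw [← sum_range_mul_blocks, windowSum, ← Finset.sum_range_add, Nat.div_add_mod]
  obtain ⟨e, he0, he1, he⟩ := key (i + n)
  obtain ⟨e', he0', he1', he'⟩ := key i
  have hle : i / B ≤ (i + n) / B := Nat.div_le_div_right (Nat.le_add_right _ _)
  simp only [windowSum_eq_sub, he, he', Nat.add_sub_cancel' hle, Finset.sum_sub_distrib]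
  rw [abs_le]
  constructor <;> linarith

theorem abs_block_length_sub_le {B : ℕ} (hB : 0 < B) (i n : ℕ) :
    |(((i + n) / B - i / B : ℕ) : ℝ) - n / B| ≤ 1 := by
  have hle : i / B ≤ (i + n) / B := Nat.div_le_div_right (Nat.le_add_right _ _)
  have e1 := Nat.div_add_mod (i + n) B
  have e2 := Nat.div_add_mod i B
  have l1 := Nat.mod_lt (i + n) hB
  have l2 := Nat.mod_lt i hB
  have hB' : (0 : ℝ) < B := by exact_mod_cast hB
  rw [Nat.cast_sub hle]
  have e1' : (B : ℝ) * ((i + n) / B : ℕ) + ((i + n) % B : ℕ) = i + n := by exact_mod_cast e1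
  have e2' : (B : ℝ) * (i / B : ℕ) + (i % B : ℕ) = i := by exact_mod_cast e2
  have l1' : (((i + n) % B : ℕ) : ℝ) < B := by exact_mod_cast l1
  have l2' : ((i % B : ℕ) : ℝ) < B := by exact_mod_cast l2
  have p1 : (0 : ℝ) ≤ ((i + n) % B : ℕ) := Nat.cast_nonneg _
  have p2 : (0 : ℝ) ≤ (i % B : ℕ) := Nat.cast_nonneg _
  set X : ℝ := (((i + n) / B : ℕ) : ℝ)
  set Y : ℝ := ((i / B : ℕ) : ℝ)
  have : X - Y - n / B = (B * X - B * Y - n) / B := by field_simp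
  rw [this, abs_div, abs_of_pos hB', div_le_one hB', abs_le]
  constructor <;> linarith

/-- If each residue class modulo `B` of a `[0, 1]`-valued sequence is controlled, so is the
sequence. -/
theorem NearMean.of_blocks {f : ℕ → ℝ} (h0 : ∀ k, 0 ≤ f k) (h1 : ∀ k, f k ≤ 1)
    {B : ℕ} (hB : 0 < B) (a ε : ℕ → ℝ)
    (h : ∀ r < B, NearMean (fun t => f (B * t + r)) (a r) (ε r)) :
    NearMean f ((∑ r ∈ Finset.range B, a r) / B) ((∑ r ∈ Finset.range B, ε r) / B) := by
  choose! K hK using h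
  -- Each residue class meets the window in $n/B$ terms up to an error of $1$, which costs `|a r| +
  -- |ε r|`; the last `B` pays for the incomplete blocks.
  refine ⟨∑ r ∈ Finset.range B, (K r + |a r| + |ε r|) + B, fun i n => ?_⟩
  have hb := abs_windowSum_sub_blocks_le h0 h1 hB i n
  have hl := abs_block_length_sub_le hB i n
  set n' := (i + n) / B - i / B with hn'
  have hr : ∀ r ∈ Finset.range B, |windowSum (fun t => f (B * t + r)) (i / B) n' - a r * (n / B)|
      ≤ ε r * (n / B) + (K r + |a r| + |ε r|) := by
    intro r hr
    have e1 := hK r (Finset.mem_range.mp hr) (i / B) n'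
    have e2 : |a r * ((n' : ℝ) - n / B)| ≤ |a r| := by
      rw [abs_mul]; exact mul_le_of_le_one_right (abs_nonneg _) hl
    have e3 : |ε r * ((n' : ℝ) - n / B)| ≤ |ε r| := by
      rw [abs_mul]; exact mul_le_of_le_one_right (abs_nonneg _) hl
    rw [abs_le] at *
    constructor <;> linarith [e3.2]
  have hs : |∑ r ∈ Finset.range B, windowSum (fun t => f (B * t + r)) (i / B) n'
      - ∑ r ∈ Finset.range B, a r * ((n : ℝ) / B)| ≤
      ∑ r ∈ Finset.range B, (ε r * ((n : ℝ) / B) + (K r + |a r| + |ε r|)) := by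
    rw [← Finset.sum_sub_distrib]
    exact (Finset.abs_sum_le_sum_abs _ _).trans (Finset.sum_le_sum hr)
  rw [← Finset.sum_mul, Finset.sum_add_distrib, ← Finset.sum_mul] at hs
  have t1 : (∑ r ∈ Finset.range B, a r) / B * n = (∑ r ∈ Finset.range B, a r) * (n / B) := by ring
  have t2 : (∑ r ∈ Finset.range B, ε r) / B * n = (∑ r ∈ Finset.range B, ε r) * (n / B) := by ring
  rw [t1, t2]
  rw [abs_le] at *
  constructor <;> linarith

theorem indicator_one_nonneg (S : Set ℕ) (k : ℕ) : 0 ≤ S.indicator (1 : ℕ → ℝ) k :=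
  Set.indicator_nonneg (fun _ _ => zero_le_one) k

theorem indicator_one_le_one (S : Set ℕ) (k : ℕ) : S.indicator (1 : ℕ → ℝ) k ≤ 1 :=
  Set.indicator_le_self' (fun _ _ => zero_le_one) k

/-- Dilating a set by the factor `B` divides its uniform density by `B`. -/
theorem HasMean.dilate {S : Set ℕ} {a : ℝ} (h : HasMean (S.indicator 1) a) {B j : ℕ}
    (hj : j < B) : HasMean ({i | i % B = j ∧ i / B ∈ S}.indicator 1) (a / B) := by
  intro ε hε
  have hB : 0 < B := by omega
  have hB' : (0 : ℝ) < B := by exact_mod_cast hB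
  have hb := NearMean.of_blocks
    (indicator_one_nonneg {i | i % B = j ∧ i / B ∈ S})
    (indicator_one_le_one {i | i % B = j ∧ i / B ∈ S}) hB
    (fun r => if r = j then a else 0) (fun _ => ε) (by
      intro r hr
      have : ∀ t, (B * t + r) / B = t := fun t => by
        rw [Nat.mul_add_div hB, Nat.div_eq_of_lt hr, add_zero]
      split_ifs with hrj
      · convert h ε hε using 1
        ext t
        subst hrj
        classical
        rw [Set.indicator_apply, Set.indicator_apply]
        simp [Nat.mod_eq_of_lt hr, this]
      · convert hasMean_zero ε hε using 1
        ext t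
        simp [Nat.mod_eq_of_lt hr, hrj])
  simpa [hj, hB'.ne'] using hb

/-! ### Frequencies from uniform densities -/

section Words

variable {A : Type*}

theorem factorAt_eq_iff {u w : ℕ → A} {i j n : ℕ} :
    factorAt u i n = factorAt w j n ↔ ∀ p < n, u (i + p) = w (j + p) := by
  simp [factorAt]

theorem factorAt_mem_language (u : ℕ → A) (i n : ℕ) : factorAt u i n ∈ language u := ⟨i, n, rfl⟩

theorem mem_factors_iff {u : ℕ → A} {n : ℕ} {w : List A} :
    w ∈ factors u n ↔ ∃ i, w = factorAt u i n := by
  constructor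
  · rintro ⟨⟨i, k, rfl⟩, h⟩
    rw [length_factorAt] at h
    exact ⟨i, h ▸ rfl⟩
  · rintro ⟨i, rfl⟩
    exact ⟨factorAt_mem_language u i n, length_factorAt u i n⟩

theorem factorAt_succ (u : ℕ → A) (i n : ℕ) :
    factorAt u i (n + 1) = u i :: factorAt u (i + 1) n := by
  rw [add_comm n 1, factorAt_add]
  simp [factorAt]

theorem factorAt_succ' (u : ℕ → A) (i n : ℕ) :
    factorAt u i (n + 1) = factorAt u i n ++ [u (i + n)] := by
  rw [factorAt_add]
  simp [factorAt]

theorem drop_factorAt (u : ℕ → A) (i n j : ℕ) (hj : j ≤ n) :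
    (factorAt u i n).drop j = factorAt u (i + j) (n - j) := by
  obtain ⟨k, rfl⟩ := Nat.exists_eq_add_of_le hj
  rw [factorAt_add, List.drop_left' (length_factorAt u i j), Nat.add_sub_cancel_left]

theorem isPrefix_factorAt_iff {u : ℕ → A} {w : List A} {i n : ℕ} :
    w <+: factorAt u i n ↔ w.length ≤ n ∧ factorAt u i w.length = w := by
  constructor
  · intro h
    have hl := h.length_le
    rw [length_factorAt] at hl
    obtain ⟨k, rfl⟩ := Nat.exists_eq_add_of_le hl
    rw [factorAt_add] at h
    exact ⟨hl, ((List.prefix_of_prefix_length_le h (List.prefix_append _ _)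
      (length_factorAt u i _).ge).eq_of_length (length_factorAt u i _).symm).symm⟩
  · rintro ⟨hl, h⟩
    obtain ⟨k, rfl⟩ := Nat.exists_eq_add_of_le hl
    rw [factorAt_add, h]
    exact List.prefix_append _ _

/-- The positions at which `w` occurs in `u`. -/
def positions (u : ℕ → A) (w : List A) : Set ℕ := {i | factorAt u i w.length = w}

/-- The counts can disagree only at starting points $j\in[n-|w|,n]$: there an occurrence may overrun
the window, and the start $j=n$ is admitted by `occurrences` alone. -/
theorem abs_occurrences_sub_windowSum_le [DecidableEq A] (u : ℕ → A) (w : List A) (i n : ℕ) :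
    |(occurrences w (factorAt u i n) : ℝ) - windowSum ((positions u w).indicator 1) i n| ≤
      w.length + 1 := by
  classical
  have h1 : (occurrences w (factorAt u i n) : ℝ) = ∑ j ∈ Finset.range (n + 1),
      if j + w.length ≤ n ∧ factorAt u (i + j) w.length = w then (1 : ℝ) else 0 := by
    rw [occurrences, length_factorAt, Finset.card_filter, Nat.cast_sum]
    refine Finset.sum_congr rfl fun j hj => ?_
    have hj' : j ≤ n := by simpa [Nat.lt_succ_iff] using hj
    rw [drop_factorAt u i n j hj', Nat.cast_ite, Nat.cast_one, Nat.cast_zero]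
    refine if_congr ?_ rfl rfl
    rw [isPrefix_factorAt_iff]
    exact and_congr_left fun _ => by omega
  have h2 : windowSum ((positions u w).indicator 1) i n = ∑ j ∈ Finset.range (n + 1),
      if j < n ∧ factorAt u (i + j) w.length = w then (1 : ℝ) else 0 := by
    rw [Finset.sum_range_succ, windowSum]
    simp only [lt_irrefl, false_and, if_false, add_zero]
    refine Finset.sum_congr rfl fun j hj => ?_
    simp [Set.indicator_apply, positions, Finset.mem_range.mp hj]
  rw [h1, h2, ← Finset.sum_sub_distrib]
  refine (Finset.abs_sum_le_sum_abs _ _).trans ?_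
  have h3 : ∀ j ∈ Finset.range (n + 1),
      |(if j + w.length ≤ n ∧ factorAt u (i + j) w.length = w then (1 : ℝ) else 0) -
        (if j < n ∧ factorAt u (i + j) w.length = w then (1 : ℝ) else 0)| ≤
      if j ∈ Finset.Ico (n - w.length) (n + 1) then 1 else 0 := by
    intro j hj
    have hj' : j < n + 1 := Finset.mem_range.mp hj
    simp only [Finset.mem_Ico]
    by_cases hw : factorAt u (i + j) w.length = w
    · simp only [hw, and_true]
      split_ifs <;> first | (exfalso; omega) | norm_num
    · simp only [hw, and_false, if_false, sub_zero, abs_zero]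
      split_ifs <;> norm_num
  refine (Finset.sum_le_sum h3).trans ?_
  rw [Finset.sum_ite_mem, Finset.sum_const, nsmul_eq_mul, mul_one]
  have : (Finset.range (n + 1) ∩ Finset.Ico (n - w.length) (n + 1)).card ≤ w.length + 1 := by
    refine (Finset.card_le_card Finset.inter_subset_right).trans ?_
    rw [Nat.card_Ico]
    omega
  exact_mod_cast this

/-- The limit defining a frequency runs over all long factors, wherever they occur; this is why
means are required to be uniform in the starting point of the window. -/
theorem HasMean.hasFrequency [DecidableEq A] {u : ℕ → A} {w : List A} {r : ℝ}
    (h : HasMean ((positions u w).indicator 1) r) : HasFrequency u w r := by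
  rw [HasFrequency, Metric.tendsto_nhds]
  intro ε hε
  obtain ⟨K, hK⟩ := h (ε / 2) (by positivity)
  obtain ⟨N, hN⟩ := exists_nat_gt ((K + w.length + 1) / (ε / 2))
  rw [eventually_inf_principal, eventually_comap]
  filter_upwards [eventually_ge_atTop (N + 1)] with n hn v hv hvL
  obtain ⟨i, k, rfl⟩ := hvL
  rw [length_factorAt] at hv
  subst hv
  have hk : (0 : ℝ) < k := by exact_mod_cast (by omega : 0 < k)
  have hkN : (N : ℝ) < k := by exact_mod_cast hn
  rw [div_lt_iff₀ (by positivity)] at hN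
  have e1 := hK i k
  have e2 := abs_occurrences_sub_windowSum_le u w i k
  rw [Real.dist_eq, length_factorAt]
  have : (occurrences w (factorAt u i k) : ℝ) / k - r =
      (occurrences w (factorAt u i k) - r * k) / k := by field_simp
  rw [this, abs_div, abs_of_pos hk, div_lt_iff₀ hk]
  have e3 : N * (ε / 2) < k * (ε / 2) := by gcongr
  rw [abs_le] at e1 e2
  rw [abs_lt]
  constructor <;> linarith

/-- Provides long factors along which to test the filter of `HasFrequency`, so that frequencies are
unique. -/
theorem tendsto_factorAt (u : ℕ → A) (i : ℕ) :
    Tendsto (factorAt u i) atTop (comap List.length atTop ⊓ 𝓟 (language u)) := by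
  refine tendsto_inf.mpr ⟨tendsto_comap_iff.mpr ?_, tendsto_principal.mpr ?_⟩
  · have : List.length ∘ factorAt u i = id := funext fun n => length_factorAt u i n
    rw [this]
    exact tendsto_id
  · exact Eventually.of_forall fun n => factorAt_mem_language u i n

theorem HasFrequency.unique [DecidableEq A] {u : ℕ → A} {w : List A} {r s : ℝ}
    (hr : HasFrequency u w r) (hs : HasFrequency u w s) : r = s :=
  tendsto_nhds_unique (hr.comp (tendsto_factorAt u 0)) (hs.comp (tendsto_factorAt u 0))

theorem finite_factors [Finite A] (u : ℕ → A) (n : ℕ) : (factors u n).Finite :=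
  (List.finite_length_eq A n).subset fun _ h => h.2

end Words

/-! ### The ruler word -/

/-- The word `v` over `ℤ/qℤ` whose `i`-th letter is the exponent of `b` in `i + 1`. -/
structure IsRulerWord (b q : ℕ) (v : ℕ → ZMod q) : Prop where
  two_le_base : 2 ≤ b
  two_le_modulus : 2 ≤ q
  apply_of_lt : ∀ i, ∀ j < b - 1, v (b * i + j) = 0
  apply_last : ∀ i, v (b * i + (b - 1)) = v i + 1

/-- The `b`-adic valuation of `n + 1`, modulo `q`. -/
def ruler (b q : ℕ) (n : ℕ) : ZMod q :=
  if h : 2 ≤ b ∧ n % b = b - 1 then ruler b q (n / b) + 1 else 0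
termination_by n
decreasing_by
  have : n ≠ 0 := by rintro rfl; simp at h; omega
  exact Nat.div_lt_self (by omega) (by omega)

theorem isRulerWord_ruler {b q : ℕ} (hb : 2 ≤ b) (hq : 2 ≤ q) : IsRulerWord b q (ruler b q) where
  two_le_base := hb
  two_le_modulus := hq
  apply_of_lt i j hj := by
    rw [ruler, dif_neg]
    rw [Nat.mul_add_mod, Nat.mod_eq_of_lt (by omega)]
    omega
  apply_last i := by
    rw [ruler, dif_pos]
    · rw [Nat.mul_add_div (by omega), Nat.div_eq_of_lt (by omega), add_zero]
    · rw [Nat.mul_add_mod, Nat.mod_eq_of_lt (by omega)]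
      exact ⟨hb, rfl⟩

/-- The word of length `n` read from position `j` in the image of `z` under the morphism
`c ↦ 0 ⋯ 0 (c + 1)` into words of length `b`. -/
def expand {q : ℕ} (b j n : ℕ) (z : List (ZMod q)) : List (ZMod q) :=
  (List.range n).map fun p => if (j + p) % b = b - 1 then z.getD ((j + p) / b) 0 + 1 else 0

theorem length_expand {q : ℕ} (b j n : ℕ) (z : List (ZMod q)) : (expand b j n z).length = n := by
  simp [expand]

theorem getElem_expand {q : ℕ} (b j n : ℕ) (z : List (ZMod q)) (p : ℕ) (hp) :
    (expand b j n z)[p]'hp =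
      if (j + p) % b = b - 1 then z.getD ((j + p) / b) 0 + 1 else 0 := by
  simp [expand]

theorem getElem_factorAt {A : Type*} (u : ℕ → A) (i n p : ℕ) (hp) :
    (factorAt u i n)[p]'hp = u (i + p) := by
  simp [factorAt]

/-- Ensures that `expand b j n z` never reads the default value of `getD` when `z` has length
$(j+n)/b$, the number of block ends inside the window. -/
theorem div_lt_of_mod_eq_pred {b j p n : ℕ} (hb : 2 ≤ b) (hp : p < n)
    (h : (j + p) % b = b - 1) : (j + p) / b < (j + n) / b := by
  have h1 := Nat.div_add_mod (j + p) b
  rw [Nat.lt_iff_add_one_le, Nat.le_div_iff_mul_le (by omega), mul_comm, Nat.mul_succ]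
  omega

/-- Letters of the expanded word are read off at the positions congruent to `b - 1 - j`. -/
theorem getElem_expand_block {q b j n c : ℕ} (hb : 2 ≤ b) (hj : j < b) (z : List (ZMod q))
    (hz : z.length = (j + n) / b) (hc : c < z.length) :
    ∃ h : b * c + (b - 1) - j < (expand b j n z).length,
      (expand b j n z)[b * c + (b - 1) - j] = z[c] + 1 := by
  have h0 : c + 1 ≤ (j + n) / b := by omega
  rw [Nat.le_div_iff_mul_le (by omega), mul_comm, Nat.mul_succ] at h0
  have h1 : j + (b * c + (b - 1) - j) = b * c + (b - 1) := by omega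
  refine ⟨by rw [length_expand]; omega, ?_⟩
  rw [getElem_expand, h1, Nat.mul_add_mod, Nat.mod_eq_of_lt (by omega), if_pos rfl,
    Nat.mul_add_div (by omega), Nat.div_eq_of_lt (by omega), add_zero,
    List.getD_eq_getElem _ _ hc]

theorem expand_injective {q b j n : ℕ} (hb : 2 ≤ b) (hj : j < b) {z z' : List (ZMod q)}
    (hz : z.length = (j + n) / b) (hz' : z'.length = (j + n) / b)
    (h : expand b j n z = expand b j n z') : z = z' := by
  refine List.ext_getElem (hz.trans hz'.symm) fun c hc hc' => ?_
  obtain ⟨h1, e1⟩ := getElem_expand_block hb hj z hz hc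
  obtain ⟨h2, e2⟩ := getElem_expand_block hb hj z' hz' hc'
  simp only [h] at e1
  exact add_right_cancel (e1.symm.trans e2)

theorem mod_eq_of_getElem_expand_ne_zero {q b j n p : ℕ} {z : List (ZMod q)} {hp}
    (h : (expand b j n z)[p]'hp ≠ 0) : (j + p) % b = b - 1 := by
  rw [getElem_expand] at h
  by_contra h'
  exact h (if_neg h')

/-- The block of the letter $-1$ is $0^b$. This is the only way the block structure can become
invisible. -/
theorem expand_replicate_neg_one {q b j n : ℕ} (hb : 2 ≤ b) :
    expand b j n (List.replicate ((j + n) / b) (-1 : ZMod q)) = List.replicate n 0 := by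
  refine List.ext_getElem (by simp [length_expand]) fun p hp hp' => ?_
  rw [getElem_expand, List.getElem_replicate]
  split_ifs with h
  · rw [length_expand] at hp
    rw [List.getD_eq_getElem _ _ (by simpa using div_lt_of_mod_eq_pred hb hp h)]
    simp
  · rfl

theorem expand_eq_replicate_zero_iff {q b j n : ℕ} (hb : 2 ≤ b) (hj : j < b)
    {z : List (ZMod q)} (hz : z.length = (j + n) / b) :
    expand b j n z = List.replicate n 0 ↔ z = List.replicate ((j + n) / b) (-1) := by
  rw [← expand_replicate_neg_one (j := j) hb]
  exact ⟨expand_injective hb hj hz (by simp), fun h => by rw [h]⟩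

theorem add_mod_inj {b i j p : ℕ} (hi : i < b) (hj : j < b)
    (h : (i + p) % b = (j + p) % b) : i = j := by
  have : i ≡ j [MOD b] := Nat.ModEq.add_right_cancel' p h
  rwa [Nat.ModEq, Nat.mod_eq_of_lt hi, Nat.mod_eq_of_lt hj] at this

theorem exists_getElem_ne_of_ne_replicate {A : Type*} {w : List A} {n : ℕ} {a : A}
    (hw : w.length = n) (h : w ≠ List.replicate n a) : ∃ p, ∃ hp : p < w.length, w[p] ≠ a := by
  by_contra! h'
  exact h (List.ext_getElem (by simp [hw]) fun p hp _ => by simp [h' p hp])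

/-- A nonzero expanded word determines the residue class at which it is read. -/
theorem residue_eq_of_expand_eq {q b j j' n : ℕ} (hj : j < b) (hj' : j' < b)
    {z z' : List (ZMod q)} (h : expand b j n z = expand b j' n z')
    (h0 : expand b j n z ≠ List.replicate n 0) : j = j' := by
  obtain ⟨p, hp, hne⟩ := exists_getElem_ne_of_ne_replicate (length_expand b j n z) h0
  have h1 := mod_eq_of_getElem_expand_ne_zero hne
  simp only [h] at hne
  exact add_mod_inj hj hj' (h1.trans (mod_eq_of_getElem_expand_ne_zero hne).symm)

/-- This length consists of $k$ complete blocks followed by $b-1$ zeros: the letters of `z`, each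
increased by $1$, are separated and framed by equal runs $0^{b-1}$. -/
theorem reverse_expand {q b k : ℕ} (hb : 2 ≤ b) (z : List (ZMod q)) (hz : z.length = k) :
    (expand b 0 (b * k + (b - 1)) z).reverse = expand b 0 (b * k + (b - 1)) z.reverse := by
  refine List.ext_getElem (by simp [length_expand]) fun p hp hp' => ?_
  rw [length_expand] at hp'
  rw [List.getElem_reverse, getElem_expand, getElem_expand, length_expand, zero_add, zero_add]
  have e := Nat.div_add_mod p b
  have hl := Nat.mod_lt p (show b > 0 by omega)
  have hk : p / b ≤ k := by
    rw [← Nat.lt_succ_iff, Nat.div_lt_iff_lt_mul (by omega), mul_comm, Nat.mul_succ]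
    omega
  generalize p / b = s at *
  generalize p % b = r at *
  obtain ⟨d, rfl⟩ := Nat.exists_eq_add_of_le hk
  rw [Nat.mul_add] at hp' ⊢
  by_cases h : r = b - 1
  · have hd : d ≠ 0 := by rintro rfl; omega
    obtain ⟨d, rfl⟩ := Nat.exists_eq_add_one_of_ne_zero hd
    have e2 : b * s + b * (d + 1) + (b - 1) - 1 - p = b * d + (b - 1) := by
      have := Nat.mul_succ b d
      simp only [Nat.succ_eq_add_one] at this
      omega
    rw [e2, if_pos h, Nat.mul_add_mod, Nat.mod_eq_of_lt (show b - 1 < b by omega), if_pos rfl,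
      Nat.mul_add_div (by omega), Nat.div_eq_of_lt (show b - 1 < b by omega), add_zero,
      List.getD_eq_getElem _ _ (by omega), List.getD_eq_getElem _ _ (by simp; omega),
      List.getElem_reverse]
    congr 2
    omega
  · have e2 : b * s + b * d + (b - 1) - 1 - p = b * d + (b - 2 - r) := by omega
    rw [e2, if_neg h, if_neg]
    rw [Nat.mul_add_mod, Nat.mod_eq_of_lt (by omega)]
    omega

/-! ### Desubstitution, synchronization and symmetry of the ruler word. -/

namespace IsRulerWord

variable {b q : ℕ} {v : ℕ → ZMod q}

theorem apply_eq (hv : IsRulerWord b q v) (i : ℕ) :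
    v i = if i % b = b - 1 then v (i / b) + 1 else 0 := by
  have hb := hv.two_le_base
  have e := Nat.div_add_mod i b
  have hl := Nat.mod_lt i (show b > 0 by omega)
  conv_lhs => rw [← e]
  split_ifs with h
  · rw [h, hv.apply_last]
  · exact hv.apply_of_lt _ _ (by omega)

theorem mod_eq_of_ne_zero (hv : IsRulerWord b q v) {i : ℕ} (h : v i ≠ 0) : i % b = b - 1 := by
  rw [hv.apply_eq] at h
  by_contra h'
  exact h (if_neg h')

theorem one_ne_zero (hv : IsRulerWord b q v) : (1 : ZMod q) ≠ 0 := by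
  have : Fact (1 < q) := ⟨hv.two_le_modulus⟩
  exact _root_.one_ne_zero

theorem neg_one_ne_zero (hv : IsRulerWord b q v) : (-1 : ZMod q) ≠ 0 :=
  neg_ne_zero.mpr hv.one_ne_zero

/-- The fixed point property read on factors: only the $(j+n)/b$ letters whose block ends inside the
window leave a trace. -/
theorem factorAt_eq_expand (hv : IsRulerWord b q v) (i j n : ℕ) :
    factorAt v (b * i + j) n = expand b j n (factorAt v i ((j + n) / b)) := by
  have hb := hv.two_le_base
  refine List.ext_getElem (by simp [length_expand, length_factorAt]) fun p hp _ => ?_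
  rw [length_factorAt] at hp
  rw [getElem_factorAt, getElem_expand, hv.apply_eq, add_assoc, Nat.mul_add_mod,
    Nat.mul_add_div (by omega)]
  refine if_ctx_congr Iff.rfl (fun h => ?_) fun _ => rfl
  have := div_lt_of_mod_eq_pred hb hp h
  rw [List.getD_eq_getElem _ _ (by rwa [length_factorAt]), getElem_factorAt]

theorem expand_mem_factors (hv : IsRulerWord b q v) (j n : ℕ) {z : List (ZMod q)}
    (hz : z ∈ factors v ((j + n) / b)) : expand b j n z ∈ factors v n := by
  rw [mem_factors_iff] at *
  obtain ⟨i, rfl⟩ := hz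
  exact ⟨b * i + j, (hv.factorAt_eq_expand i j n).symm⟩

theorem exists_eq_expand (hv : IsRulerWord b q v) {n : ℕ} {w : List (ZMod q)}
    (hw : w ∈ factors v n) :
    ∃ j < b, ∃ z ∈ factors v ((j + n) / b), w = expand b j n z := by
  have hb := hv.two_le_base
  rw [mem_factors_iff] at hw
  obtain ⟨i, rfl⟩ := hw
  refine ⟨i % b, Nat.mod_lt _ (by omega), factorAt v (i / b) ((i % b + n) / b),
    mem_factors_iff.mpr ⟨_, rfl⟩, ?_⟩
  rw [← hv.factorAt_eq_expand, Nat.div_add_mod]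

theorem exists_apply_eq_natCast (hv : IsRulerWord b q v) (k : ℕ) : ∃ i, v i = k ∧ k ≤ i := by
  have hb := hv.two_le_base
  induction k with
  | zero => exact ⟨0, by simpa using hv.apply_of_lt 0 0 (by omega), le_rfl⟩
  | succ k ih =>
    obtain ⟨i, hi, hk⟩ := ih
    refine ⟨b * i + (b - 1), by rw [hv.apply_last, hi]; push_cast; ring, ?_⟩
    have := Nat.le_mul_of_pos_left i (show 0 < b by omega)
    omega

theorem exists_apply_eq (hv : IsRulerWord b q v) (c : ZMod q) : ∃ i, v i = c := by
  have : NeZero q := ⟨by have := hv.two_le_modulus; omega⟩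
  obtain ⟨i, hi, -⟩ := hv.exists_apply_eq_natCast c.val
  exact ⟨i, by rw [hi, ZMod.natCast_zmod_val]⟩

theorem singleton_mem_factors (hv : IsRulerWord b q v) (c : ZMod q) : [c] ∈ factors v 1 := by
  obtain ⟨i, rfl⟩ := hv.exists_apply_eq c
  exact mem_factors_iff.mpr ⟨i, by simp [factorAt]⟩

theorem mem_factors_one_iff (hv : IsRulerWord b q v) {z : List (ZMod q)} :
    z ∈ factors v 1 ↔ ∃ c, z = [c] := by
  constructor
  · intro h
    exact List.length_eq_one_iff.mp h.2
  · rintro ⟨c, rfl⟩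
    exact hv.singleton_mem_factors c

theorem mem_factors_zero_iff {z : List (ZMod q)} : z ∈ factors v 0 ↔ z = [] := by
  constructor
  · intro h
    exact List.length_eq_zero_iff.mp h.2
  · rintro rfl
    exact mem_factors_iff.mpr ⟨0, rfl⟩

theorem apply_succ_eq_zero (hv : IsRulerWord b q v) {i : ℕ} (h : v i ≠ 0) : v (i + 1) = 0 := by
  have hb := hv.two_le_base
  by_contra h'
  have h1 := hv.mod_eq_of_ne_zero h
  have h2 := hv.mod_eq_of_ne_zero h'
  rw [Nat.add_mod, h1, Nat.mod_eq_of_lt (show 1 < b by omega), show b - 1 + 1 = b by omega,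
    Nat.mod_self] at h2
  omega

/-- Nonzero letters are isolated and $-1\ne0$. Thus a zero factor has a preimage of length at most
$1$, which bounds the length of zero factors. -/
theorem replicate_neg_one_mem_factors_iff (hv : IsRulerWord b q v) {k : ℕ} :
    List.replicate k (-1) ∈ factors v k ↔ k ≤ 1 := by
  constructor
  · intro h
    by_contra! hk
    obtain ⟨i, hi⟩ := mem_factors_iff.mp h
    obtain ⟨k, rfl⟩ := Nat.exists_eq_add_of_le hk
    have e : ∀ p < 2 + k, v (i + p) = -1 := by
      intro p hp
      have := getElem_factorAt v i (2 + k) p (by rw [length_factorAt]; exact hp)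
      simp only [← hi, List.getElem_replicate] at this
      exact this.symm
    have h0 := e 0 (by omega)
    have h1 := e 1 (by omega)
    have := hv.apply_succ_eq_zero (i := i) (by rw [add_zero] at h0; rw [h0]; exact hv.neg_one_ne_zero)
    rw [this] at h1
    exact hv.neg_one_ne_zero h1.symm
  · intro h
    interval_cases k
    · exact mem_factors_zero_iff.mpr rfl
    · exact hv.singleton_mem_factors _

theorem add_lt_of_expand_eq_replicate_zero (hv : IsRulerWord b q v) {j n : ℕ} (hj : j < b)
    {z : List (ZMod q)} (hz : z ∈ factors v ((j + n) / b))
    (h : expand b j n z = List.replicate n 0) : j + n < 2 * b := by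
  have hb := hv.two_le_base
  rw [expand_eq_replicate_zero_iff hb hj hz.2] at h
  rw [h, hv.replicate_neg_one_mem_factors_iff] at hz
  exact (Nat.div_lt_iff_lt_mul (by omega)).mp (by omega)

/-- The longest zero run comes from the letter $-1$: its block $0^b$ is followed by the $b-1$
initial zeros of the next block. -/
theorem replicate_zero_mem_factors_iff (hv : IsRulerWord b q v) {n : ℕ} :
    List.replicate n 0 ∈ factors v n ↔ n ≤ 2 * b - 1 := by
  have hb := hv.two_le_base
  constructor
  · intro h
    obtain ⟨j, hj, z, hz, he⟩ := hv.exists_eq_expand h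
    have := hv.add_lt_of_expand_eq_replicate_zero hj hz he.symm
    omega
  · intro h
    rw [← expand_replicate_neg_one (j := 0) hb]
    refine hv.expand_mem_factors 0 n (hv.replicate_neg_one_mem_factors_iff.mpr ?_)
    rw [← Nat.lt_succ_iff, Nat.div_lt_iff_lt_mul (by omega)]
    omega

/-- Factors that are nonzero or have length at least `2 * b - 1` determine the residue class modulo
`b` of their positions. -/
theorem residue_eq (hv : IsRulerWord b q v) {j j' n : ℕ} (hj : j < b) (hj' : j' < b)
    {z z' : List (ZMod q)} (hz : z ∈ factors v ((j + n) / b)) (hz' : z' ∈ factors v ((j' + n) / b))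
    (h : expand b j n z = expand b j' n z')
    (h0 : expand b j n z ≠ List.replicate n 0 ∨ 2 * b - 1 ≤ n) : j = j' := by
  by_cases hne : expand b j n z = List.replicate n 0
  · have hn := h0.resolve_left (not_not.mpr hne)
    -- A zero word satisfies $j+n<2b$, so $n\ge 2b-1$ forces $j=0$, and likewise $j'=0$.
    have h1 := hv.add_lt_of_expand_eq_replicate_zero hj hz hne
    have h2 := hv.add_lt_of_expand_eq_replicate_zero hj' hz' (h ▸ hne)
    omega
  · exact residue_eq_of_expand_eq hj hj' h hne

theorem factorAt_eq_expand_iff (hv : IsRulerWord b q v) {i j n : ℕ} (hj : j < b)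
    {z : List (ZMod q)} (hz : z ∈ factors v ((j + n) / b))
    (h0 : expand b j n z ≠ List.replicate n 0 ∨ 2 * b - 1 ≤ n) :
    factorAt v i n = expand b j n z ↔ i % b = j ∧ factorAt v (i / b) ((j + n) / b) = z := by
  have hb := hv.two_le_base
  have e : factorAt v i n = expand b (i % b) n (factorAt v (i / b) ((i % b + n) / b)) := by
    rw [← hv.factorAt_eq_expand, Nat.div_add_mod]
  constructor
  · intro h
    have hr := hv.residue_eq hj (Nat.mod_lt i (by omega)) hz (mem_factors_iff.mpr ⟨_, rfl⟩)
      (h.symm.trans e) h0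
    refine ⟨hr.symm, ?_⟩
    rw [e, ← hr] at h
    exact expand_injective hb hj (length_factorAt _ _ _) hz.2 h
  · rintro ⟨rfl, rfl⟩
    exact e

/-- The ruler word is symmetric about the multiples of powers of `b`. -/
theorem apply_mirror (hv : IsRulerWord b q v) (L i : ℕ) (hi : i + 1 < b ^ L) :
    v (b ^ L - 2 - i) = v i := by
  have hb := hv.two_le_base
  -- In terms of $i+1$ the map is $x\mapsto b^L-x$, which preserves the exponent of $b$ for
  -- $0<x<b^L$. The induction strips the last digit of $i$.
  induction L generalizing i with
  | zero => simp at hi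
  | succ L ih =>
    have e := Nat.div_add_mod i b
    have hl := Nat.mod_lt i (show b > 0 by omega)
    rw [pow_succ, mul_comm] at hi ⊢
    have hlt : i / b < b ^ L := by
      rw [Nat.div_lt_iff_lt_mul (by omega), mul_comm]
      omega
    obtain ⟨d, hd⟩ := Nat.exists_eq_add_of_lt hlt
    rw [hv.apply_eq i]
    split_ifs with h
    · have hd0 : d ≠ 0 := by
        rintro rfl
        rw [hd, Nat.mul_add, Nat.mul_add] at hi
        omega
      obtain ⟨c, rfl⟩ := Nat.exists_eq_add_one_of_ne_zero hd0
      have := ih (i / b) (by omega)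
      rw [show b * b ^ L - 2 - i = b * (b ^ L - 2 - i / b) + (b - 1) by
        rw [hd, show i / b + (c + 1) + 1 - 2 - i / b = c by omega, Nat.mul_add, Nat.mul_add,
          Nat.mul_add]
        omega, hv.apply_last, this]
    · rw [show b * b ^ L - 2 - i = b * d + (b - 2 - i % b) by
        rw [hd, Nat.mul_add, Nat.mul_add]
        omega]
      exact hv.apply_of_lt _ _ (by omega)

/-- The occurrence is reflected inside the prefix preceding a power of $b$ large enough to contain
it. -/
theorem reverse_mem_factors (hv : IsRulerWord b q v) {n : ℕ} {z : List (ZMod q)}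
    (hz : z ∈ factors v n) : z.reverse ∈ factors v n := by
  have hb := hv.two_le_base
  rw [mem_factors_iff] at *
  obtain ⟨i, rfl⟩ := hz
  have hL : i + n + 2 < b ^ (i + n + 2) := Nat.lt_pow_self (by omega)
  refine ⟨b ^ (i + n + 2) - 1 - i - n, ?_⟩
  refine List.ext_getElem (by simp [length_factorAt]) fun p hp hp' => ?_
  rw [length_factorAt] at hp'
  rw [List.getElem_reverse, getElem_factorAt, getElem_factorAt, length_factorAt,
    ← hv.apply_mirror (i + n + 2) _ (by omega)]
  congr 1
  omega

/-- Adding a multiple of $b^L$ does not change the exponent of $b$ in a positive number below $b^L$.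
-/
theorem apply_block (hv : IsRulerWord b q v) (L i r : ℕ) (hr : r + 1 < b ^ L) :
    v (b ^ L * i + r) = v r := by
  have hb := hv.two_le_base
  induction L generalizing r with
  | zero => simp at hr
  | succ L ih =>
    have e := Nat.div_add_mod r b
    have hl := Nat.mod_lt r (show b > 0 by omega)
    rw [pow_succ, mul_comm] at hr
    rw [pow_succ, mul_comm (b ^ L) b, mul_assoc, hv.apply_eq, hv.apply_eq r, Nat.mul_add_mod,
      Nat.mul_add_div (by omega)]
    refine if_ctx_congr Iff.rfl (fun h => ?_) fun _ => rfl
    rw [ih]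
    have h2 : b * (r / b + 1) < b * b ^ L := by rw [Nat.mul_succ]; omega
    exact Nat.lt_of_mul_lt_mul_left h2

end IsRulerWord

/-! ### One-letter extensions in terms of positions. -/

section Words

variable {A : Type*} {u : ℕ → A} {w : List A} {a : A}

theorem mem_leftExtensions_iff :
    a ∈ leftExtensions u w ↔ ∃ i, u i = a ∧ factorAt u (i + 1) w.length = w := by
  constructor
  · rintro ⟨i, n, h⟩
    have hn : n = w.length + 1 := by simpa [length_factorAt] using (congrArg List.length h).symm
    rw [hn, factorAt_succ, List.cons.injEq] at h
    exact ⟨i, h.1.symm, h.2.symm⟩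
  · rintro ⟨i, rfl, h⟩
    exact ⟨i, w.length + 1, by rw [factorAt_succ, h]⟩

theorem mem_rightExtensions_iff :
    a ∈ rightExtensions u w ↔ ∃ i, factorAt u i w.length = w ∧ u (i + w.length) = a := by
  constructor
  · rintro ⟨i, n, h⟩
    have hn : n = w.length + 1 := by simpa [length_factorAt] using (congrArg List.length h).symm
    rw [hn, factorAt_succ'] at h
    obtain ⟨h1, h2⟩ := List.append_inj h (by rw [length_factorAt])
    exact ⟨i, h1.symm, by simpa using h2.symm⟩
  · rintro ⟨i, h, rfl⟩
    exact ⟨i, w.length + 1, by rw [factorAt_succ', h]⟩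

theorem complexity_zero : complexity u 0 = 1 := by
  have : factors u 0 = {[]} := by
    ext z
    rw [Set.mem_singleton_iff]
    exact ⟨fun h => List.length_eq_zero_iff.mp h.2, fun h => mem_factors_iff.mpr ⟨0, h⟩⟩
  rw [complexity, this, Set.ncard_singleton]

end Words

namespace IsRulerWord

variable {b q : ℕ} {v : ℕ → ZMod q}

theorem neZero (hv : IsRulerWord b q v) : NeZero q := ⟨by have := hv.two_le_modulus; omega⟩

theorem finite_factors (hv : IsRulerWord b q v) (n : ℕ) : (factors v n).Finite := by
  have := hv.neZero
  exact FactorFrequency.finite_factors v n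

/-! ### Factor complexity of the ruler word -/

theorem complexity_one (hv : IsRulerWord b q v) : complexity v 1 = q := by
  have := hv.neZero
  have h : factors v 1 = (fun c => [c]) '' (Set.univ : Set (ZMod q)) := by
    ext z
    rw [hv.mem_factors_one_iff]
    simp [eq_comm]
  rw [complexity, h, Set.ncard_image_of_injective _ (fun _ _ h => by simpa using h),
    Set.ncard_univ, Nat.card_zmod]

/-- Sorts the nonzero factors by residue class. The classes are disjoint because a nonzero word
reveals its residue, and the all-$(-1)$ preimages are exactly those giving zero. -/
theorem nonzero_factors_eq_biUnion (hv : IsRulerWord b q v) (n : ℕ) :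
    factors v n \ {List.replicate n 0} = ⋃ j ∈ Finset.range b, expand b j n ''
      (factors v ((j + n) / b) \ {List.replicate ((j + n) / b) (-1)}) := by
  have hb := hv.two_le_base
  ext w
  simp only [Set.mem_iUnion, Finset.mem_range, Set.mem_image, Set.mem_sdiff,
    Set.mem_singleton_iff, exists_prop]
  constructor
  · rintro ⟨hw, h0⟩
    obtain ⟨j, hj, z, hz, rfl⟩ := hv.exists_eq_expand hw
    exact ⟨j, hj, z, ⟨hz, fun h => h0 ((expand_eq_replicate_zero_iff hb hj hz.2).mpr h)⟩, rfl⟩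
  · rintro ⟨j, hj, z, ⟨hz, h0⟩, rfl⟩
    exact ⟨hv.expand_mem_factors j n hz,
      fun h => h0 ((expand_eq_replicate_zero_iff hb hj hz.2).mp h)⟩

theorem complexity_eq_sum (hv : IsRulerWord b q v) (n : ℕ) :
    complexity v n = ∑ j ∈ Finset.range b,
      (factors v ((j + n) / b) \ {List.replicate ((j + n) / b) (-1)}).ncard +
      if n ≤ 2 * b - 1 then 1 else 0 := by
  have hb := hv.two_le_base
  have h1 : (factors v n \ {List.replicate n 0}).ncard = ∑ j ∈ Finset.range b,
      (factors v ((j + n) / b) \ {List.replicate ((j + n) / b) (-1)}).ncard := by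
    rw [hv.nonzero_factors_eq_biUnion]
    refine (Set.Finite.ncard_biUnion (Finset.finite_toSet _)
      (fun j _ => ((hv.finite_factors _).sdiff).image _) ?_).trans ?_
    · intro j hj j' hj' hne
      rw [Finset.mem_coe, Finset.mem_range] at hj hj'
      refine Set.disjoint_left.mpr ?_
      rintro _ ⟨z, ⟨hz, h0⟩, rfl⟩ ⟨z', ⟨hz', -⟩, h⟩
      exact hne (residue_eq_of_expand_eq hj hj' h.symm
        fun h => h0 ((expand_eq_replicate_zero_iff hb hj hz.2).mp h))
    · rw [finsum_mem_coe_finset]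
      refine Finset.sum_congr rfl fun j hj => Set.InjOn.ncard_image fun z hz z' hz' h => ?_
      exact expand_injective hb (Finset.mem_range.mp hj) hz.1.2 hz'.1.2 h
  rw [← h1, complexity]
  split_ifs with h
  · exact (Set.ncard_sdiff_singleton_add_one (hv.replicate_zero_mem_factors_iff.mpr h)
      (hv.finite_factors n)).symm
  · rw [add_zero, Set.sdiff_singleton_eq_self fun h' => h (hv.replicate_zero_mem_factors_iff.mp h')]

theorem ncard_factors_sdiff (hv : IsRulerWord b q v) (k : ℕ) :
    (factors v k \ {List.replicate k (-1)}).ncard + (if k ≤ 1 then 1 else 0) =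
      complexity v k := by
  split_ifs with h
  · exact Set.ncard_sdiff_singleton_add_one (hv.replicate_neg_one_mem_factors_iff.mpr h)
      (hv.finite_factors k)
  · rw [add_zero, Set.sdiff_singleton_eq_self
      fun h' => h (hv.replicate_neg_one_mem_factors_iff.mp h'), complexity]

/-- Passing from $n$ to $n+1$ shifts the quotients $(j+n)/b$ from $0\le j<b$ to $1\le j\le b$: the
sum telescopes, losing $n/b$ and gaining $n/b+1$. The conditionals account for the zero words and
their preimages; all terms are kept positive to avoid truncated subtraction. -/
theorem complexity_succ (hv : IsRulerWord b q v) (n : ℕ) :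
    complexity v (n + 1) + complexity v (n / b) + (if n / b + 1 ≤ 1 then 1 else 0) +
        (if n ≤ 2 * b - 1 then 1 else 0) =
      complexity v n + complexity v (n / b + 1) + (if n / b ≤ 1 then 1 else 0) +
        (if n + 1 ≤ 2 * b - 1 then 1 else 0) := by
  have hb := hv.two_le_base
  rw [← hv.ncard_factors_sdiff (n / b), ← hv.ncard_factors_sdiff (n / b + 1),
    hv.complexity_eq_sum (n + 1), hv.complexity_eq_sum n]
  have h := (Finset.sum_range_succ (fun j => (factors v ((j + n) / b) \
    {List.replicate ((j + n) / b) (-1)}).ncard) b).symm.trans (Finset.sum_range_succ' _ b)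
  rw [zero_add, Nat.add_div_left _ (show 0 < b by omega)] at h
  simp only [add_right_comm _ 1 n, add_assoc _ n 1] at h ⊢
  omega

theorem complexity_succ_of_lt (hv : IsRulerWord b q v) {n : ℕ} (hn : n < b) :
    complexity v (n + 1) + 1 = complexity v n + q := by
  have hb := hv.two_le_base
  have h := hv.complexity_succ n
  rw [Nat.div_eq_of_lt hn, complexity_zero, hv.complexity_one] at h
  rw [if_pos (by omega), if_pos (by omega), if_pos (by omega), if_pos (by omega)] at h
  omega

theorem complexity_two (hv : IsRulerWord b q v) : complexity v 2 + 1 = 2 * q := by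
  have hb := hv.two_le_base
  have := hv.complexity_succ_of_lt (n := 1) (by omega)
  rw [hv.complexity_one, one_add_one_eq_two] at this
  omega

theorem complexity_succ_of_le_of_le (hv : IsRulerWord b q v) {n : ℕ} (hn : b ≤ n)
    (hn' : n ≤ 2 * b - 2) : complexity v (n + 1) = complexity v n + q := by
  have hb := hv.two_le_base
  have h := hv.complexity_succ n
  have h1 : n / b = 1 := Nat.div_eq_of_lt_le (by omega) (by omega)
  have h2 := hv.complexity_two
  rw [h1, hv.complexity_one, one_add_one_eq_two] at h
  rw [if_neg (by omega), if_pos (by omega), if_pos (by omega), if_pos (by omega)] at h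
  omega

/-- Here $n/b\le1$ and $n\le 2b-1$ are equivalent, so the boundary corrections cancel and the
increment at $n$ is the increment at $n/b$. This recursion drives the later inductions. -/
theorem complexity_succ_of_ge (hv : IsRulerWord b q v) {n : ℕ} (hn : 2 * b - 1 ≤ n) :
    complexity v (n + 1) + complexity v (n / b) = complexity v n + complexity v (n / b + 1) := by
  have hb := hv.two_le_base
  have h := hv.complexity_succ n
  have h1 : 1 ≤ n / b := (Nat.le_div_iff_mul_le (by omega)).mpr (by omega)
  have h2 : n / b ≤ 1 ↔ n ≤ 2 * b - 1 := by
    rw [← Nat.lt_succ_iff, Nat.div_lt_iff_lt_mul (by omega)]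
    omega
  simp only [h2] at h
  rw [if_neg (by omega), if_neg (show ¬ n + 1 ≤ 2 * b - 1 by omega)] at h
  omega

/-! ### Bispecial factors of the ruler word -/

theorem mod_eq_of_factorAt_eq (hv : IsRulerWord b q v) {i i' n : ℕ}
    (h : factorAt v i n = factorAt v i' n)
    (h0 : factorAt v i n ≠ List.replicate n 0 ∨ 2 * b - 1 ≤ n) : i % b = i' % b := by
  have hb := hv.two_le_base
  have e : ∀ i, factorAt v i n = expand b (i % b) n (factorAt v (i / b) ((i % b + n) / b)) := by
    intro i
    rw [← hv.factorAt_eq_expand, Nat.div_add_mod]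
  rw [e i'] at h
  rw [e i] at h h0
  exact hv.residue_eq (Nat.mod_lt _ (by omega)) (Nat.mod_lt _ (by omega))
    (mem_factors_iff.mpr ⟨_, rfl⟩) (mem_factors_iff.mpr ⟨_, rfl⟩) h h0

theorem div_block (hv : IsRulerWord b q v) (k : ℕ) : (0 + (b * k + (b - 1))) / b = k := by
  have hb := hv.two_le_base
  rw [zero_add, Nat.mul_add_div (by omega), Nat.div_eq_of_lt (by omega), add_zero]

theorem factorAt_mul_eq_expand (hv : IsRulerWord b q v) (i k : ℕ) :
    factorAt v (b * i) (b * k + (b - 1)) = expand b 0 (b * k + (b - 1)) (factorAt v i k) := by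
  have := hv.factorAt_eq_expand i 0 (b * k + (b - 1))
  rwa [hv.div_block, add_zero] at this

theorem expand_zero_mem_factors (hv : IsRulerWord b q v) {k : ℕ} {z : List (ZMod q)}
    (hz : z ∈ factors v k) : expand b 0 (b * k + (b - 1)) z ∈ factors v (b * k + (b - 1)) :=
  hv.expand_mem_factors 0 _ (by rwa [hv.div_block])

theorem succ_mem_leftExtensions_expand (hv : IsRulerWord b q v) {a : ZMod q} {k : ℕ}
    {z : List (ZMod q)} (hz : z.length = k) (ha : a ∈ leftExtensions v z) :
    a + 1 ∈ leftExtensions v (expand b 0 (b * k + (b - 1)) z) := by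
  have hb := hv.two_le_base
  rw [mem_leftExtensions_iff] at *
  obtain ⟨i, rfl, h⟩ := ha
  refine ⟨b * i + (b - 1), hv.apply_last i, ?_⟩
  rw [length_expand, show b * i + (b - 1) + 1 = b * (i + 1) by rw [Nat.mul_add]; omega,
    hv.factorAt_mul_eq_expand, ← hz, h]

theorem succ_mem_rightExtensions_expand (hv : IsRulerWord b q v) {a : ZMod q} {k : ℕ}
    {z : List (ZMod q)} (hz : z.length = k) (ha : a ∈ rightExtensions v z) :
    a + 1 ∈ rightExtensions v (expand b 0 (b * k + (b - 1)) z) := by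
  rw [mem_rightExtensions_iff] at *
  obtain ⟨i, h, rfl⟩ := ha
  refine ⟨b * i, ?_, ?_⟩
  · rw [length_expand, hv.factorAt_mul_eq_expand, ← hz, h]
  · rw [length_expand, ← add_assoc, ← Nat.mul_add, hv.apply_last, hz]

theorem expand_mem_bispecialFactors (hv : IsRulerWord b q v) {k : ℕ} {z : List (ZMod q)}
    (hz : z ∈ bispecialFactors v k) :
    expand b 0 (b * k + (b - 1)) z ∈ bispecialFactors v (b * k + (b - 1)) := by
  obtain ⟨hz, ⟨a, ha, a', ha', hne⟩, ⟨c, hc, c', hc', hne'⟩⟩ := hz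
  exact ⟨hv.expand_zero_mem_factors hz,
    ⟨_, hv.succ_mem_leftExtensions_expand hz.2 ha, _, hv.succ_mem_leftExtensions_expand hz.2 ha',
      fun h => hne (add_right_cancel h)⟩,
    ⟨_, hv.succ_mem_rightExtensions_expand hz.2 hc, _,
      hv.succ_mem_rightExtensions_expand hz.2 hc', fun h => hne' (add_right_cancel h)⟩⟩

/-- All occurrences of `w` lie in one residue class. A nonzero left extension puts the start of `w`
at the start of a block, and a nonzero right extension puts its end just before the last letter of a
block. Extension letters of `w` and of its preimage then differ by $1$. -/
theorem exists_eq_expand_of_mem_bispecialFactors (hv : IsRulerWord b q v) {n : ℕ}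
    {w : List (ZMod q)} (hw : w ∈ bispecialFactors v n)
    (h0 : w ≠ List.replicate n 0 ∨ 2 * b - 1 ≤ n) :
    ∃ k, n = b * k + (b - 1) ∧ ∃ z ∈ bispecialFactors v k, w = expand b 0 n z := by
  have hb := hv.two_le_base
  obtain ⟨⟨-, hwn⟩, hl, hr⟩ := hw
  have occ : ∀ {i i'}, factorAt v i n = w → factorAt v i' n = w → i % b = i' % b :=
    fun h h' => hv.mod_eq_of_factorAt_eq (h.trans h'.symm) (h ▸ h0)
  -- Of two distinct extensions one is nonzero, and nonzero letters stand only at positions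
  -- congruent to $b-1$.
  obtain ⟨a, ha, ha0⟩ := hl.exists_ne 0
  obtain ⟨c, hc, hc0⟩ := hr.exists_ne 0
  obtain ⟨i, rfl, hi⟩ := mem_leftExtensions_iff.mp ha
  obtain ⟨i', hi', rfl⟩ := mem_rightExtensions_iff.mp hc
  rw [hwn] at hi hi' hc0
  have hi0 : (i + 1) % b = 0 := by
    rw [Nat.add_mod, hv.mod_eq_of_ne_zero ha0, Nat.mod_eq_of_lt (show 1 < b by omega),
      show b - 1 + 1 = b by omega, Nat.mod_self]
  have occ0 : ∀ {i'}, factorAt v i' n = w → i' % b = 0 := fun h => (occ h hi).trans hi0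
  have hn : n % b = b - 1 := by
    have := hv.mod_eq_of_ne_zero hc0
    rwa [Nat.add_mod, occ0 hi', zero_add, Nat.mod_mod] at this
  have hnk : n = b * (n / b) + (b - 1) := by
    conv_lhs => rw [← Nat.div_add_mod n b, hn]
  generalize n / b = k at hnk
  subst hnk
  have shape : ∀ {i'}, factorAt v i' (b * k + (b - 1)) = w →
      i' = b * (i' / b) ∧ w = expand b 0 (b * k + (b - 1)) (factorAt v (i' / b) k) := by
    intro i' h
    have e := Nat.div_add_mod i' b
    rw [occ0 h, add_zero] at e
    exact ⟨e.symm, by rw [← hv.factorAt_mul_eq_expand, e, h]⟩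
  set z := factorAt v (i' / b) k with hz
  have hwz : w = expand b 0 (b * k + (b - 1)) z := (shape hi').2
  have derived : ∀ {i'}, factorAt v i' (b * k + (b - 1)) = w → factorAt v (i' / b) k = z := by
    intro i' h
    refine expand_injective (j := 0) (n := b * k + (b - 1)) hb (by omega) ?_ ?_
      ((shape h).2.symm.trans hwz)
    · rw [length_factorAt, hv.div_block]
    · rw [length_factorAt, hv.div_block]
  have hzl : z.length = k := length_factorAt _ _ _
  refine ⟨k, rfl, z, ⟨mem_factors_iff.mpr ⟨_, rfl⟩, ?_, ?_⟩, hwz⟩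
  · have key : ∀ a ∈ leftExtensions v w, a - 1 ∈ leftExtensions v z := by
      intro a ha
      obtain ⟨s, rfl, hs⟩ := mem_leftExtensions_iff.mp ha
      rw [hwn] at hs
      -- The occurrence starts at $s+1$, a positive multiple of $b$; thus $s$ is the last position
      -- of block $t$.
      obtain ⟨t, ht⟩ : ∃ t, (s + 1) / b = t + 1 := by
        refine Nat.exists_eq_add_one_of_ne_zero fun h => ?_
        have := (shape hs).1
        rw [h] at this
        omega
      have e : s = b * t + (b - 1) := by
        have := (shape hs).1
        rw [ht, Nat.mul_add] at this
        omega
      refine mem_leftExtensions_iff.mpr ⟨t, ?_, ?_⟩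
      · rw [e, hv.apply_last, add_sub_cancel_right]
      · rw [hzl, ← ht, derived hs]
    obtain ⟨a, ha, a', ha', hne⟩ := hl
    exact ⟨_, key a ha, _, key a' ha', fun h => hne (sub_left_injective h)⟩
  · have key : ∀ a ∈ rightExtensions v w, a - 1 ∈ rightExtensions v z := by
      intro a ha
      obtain ⟨s, hs, rfl⟩ := mem_rightExtensions_iff.mp ha
      rw [hwn] at hs ⊢
      refine mem_rightExtensions_iff.mpr ⟨s / b, ?_, ?_⟩
      · rw [hzl, derived hs]
      · have e : s + (b * k + (b - 1)) = b * (s / b + k) + (b - 1) := by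
          rw [Nat.mul_add, ← (shape hs).1, add_assoc]
        rw [e, hv.apply_last, add_sub_cancel_right, hzl]
    obtain ⟨a, ha, a', ha', hne⟩ := hr
    exact ⟨_, key a ha, _, key a' ha', fun h => hne (sub_left_injective h)⟩

/-- A nonzero one would have length $bk+b-1\le 2b-2$, hence $k=0$; but the expansion of the empty
word is $0^{b-1}$. -/
theorem eq_replicate_of_mem_bispecialFactors (hv : IsRulerWord b q v) {n : ℕ}
    (hn : n ≤ 2 * b - 2) {w : List (ZMod q)} (hw : w ∈ bispecialFactors v n) :
    w = List.replicate n 0 := by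
  have hb := hv.two_le_base
  by_contra h
  obtain ⟨k, rfl, z, hz, rfl⟩ := hv.exists_eq_expand_of_mem_bispecialFactors hw (Or.inl h)
  have hk : k = 0 := by
    by_contra hk
    have := Nat.le_mul_of_pos_right b (Nat.pos_of_ne_zero hk)
    omega
  subst hk
  refine h ((expand_eq_replicate_zero_iff hb (by omega) ?_).mpr ?_)
  · rw [hv.div_block]; exact hz.1.2
  · rw [hv.div_block]; exact List.length_eq_zero_iff.mp hz.1.2

theorem ncard_bispecialFactors_le_one (hv : IsRulerWord b q v) {n : ℕ} (hn : n ≤ 2 * b - 2) :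
    (bispecialFactors v n).ncard ≤ 1 := by
  have h : bispecialFactors v n ⊆ {List.replicate n 0} :=
    fun w hw => hv.eq_replicate_of_mem_bispecialFactors hn hw
  simpa using Set.ncard_le_ncard h

theorem bispecialFactors_block_eq (hv : IsRulerWord b q v) {k : ℕ} (hk : 1 ≤ k) :
    bispecialFactors v (b * k + (b - 1)) =
      expand b 0 (b * k + (b - 1)) '' bispecialFactors v k := by
  have hb := hv.two_le_base
  have hbk := Nat.le_mul_of_pos_right b hk
  ext w
  constructor
  · intro hw
    obtain ⟨k', hk', z, hz, rfl⟩ :=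
      hv.exists_eq_expand_of_mem_bispecialFactors hw (Or.inr (by omega))
    have : k = k' := Nat.eq_of_mul_eq_mul_left (show 0 < b by omega) (by omega)
    subst this
    exact ⟨z, hz, rfl⟩
  · rintro ⟨z, hz, rfl⟩
    exact hv.expand_mem_bispecialFactors hz

theorem ncard_bispecialFactors_block_le (hv : IsRulerWord b q v) {k : ℕ} (hk : 1 ≤ k) :
    (bispecialFactors v (b * k + (b - 1))).ncard ≤ (bispecialFactors v k).ncard := by
  rw [hv.bispecialFactors_block_eq hk]
  exact Set.ncard_image_le ((hv.finite_factors k).subset fun _ h => h.1)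

theorem ncard_bispecialFactors_eq_zero (hv : IsRulerWord b q v) {n : ℕ} (hn : 2 * b - 1 ≤ n)
    (h : ¬ b ∣ n + 1) : (bispecialFactors v n).ncard = 0 := by
  have hb := hv.two_le_base
  have : bispecialFactors v n = ∅ := by
    refine Set.eq_empty_of_forall_notMem fun w hw => h ?_
    obtain ⟨k, hk, -⟩ := hv.exists_eq_expand_of_mem_bispecialFactors hw (Or.inr hn)
    exact ⟨k + 1, by rw [Nat.mul_add]; omega⟩
  rw [this, Set.ncard_empty]

/-- An occurrence of $-1$ has neighbours $0$, and the image of $0\,(-1)\,0$ contains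
$1\,0^{2b-1}\,1$. The two occurrences of $0^{2b-2}$ in this run supply both extensions on either
side. -/
theorem bispecialFactors_two_mul_sub_two (hv : IsRulerWord b q v) :
    bispecialFactors v (2 * b - 2) = {List.replicate (2 * b - 2) 0} := by
  have hb := hv.two_le_base
  refine Set.Subset.antisymm (fun w hw => hv.eq_replicate_of_mem_bispecialFactors le_rfl hw) ?_
  rintro _ rfl
  obtain ⟨s, hs⟩ := hv.exists_apply_eq (-1)
  have hs0 : v (s + 1) = 0 := hv.apply_succ_eq_zero (by rw [hs]; exact hv.neg_one_ne_zero)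
  have hzero : ∀ t p, v t = -1 → p < 2 * b - 1 → v (b * t + p) = 0 := by
    intro t p ht hp
    rcases lt_trichotomy p (b - 1) with h | h | h
    · exact hv.apply_of_lt t p h
    · rw [h, hv.apply_last, ht, neg_add_cancel]
    · rw [show b * t + p = b * (t + 1) + (p - b) by rw [Nat.mul_add]; omega]
      exact hv.apply_of_lt _ _ (by omega)
  have word : ∀ i, (∀ p < 2 * b - 2, v (i + p) = 0) →
      factorAt v i (2 * b - 2) = List.replicate (2 * b - 2) 0 := by
    intro i h
    refine List.ext_getElem (by simp [length_factorAt]) fun p hp _ => ?_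
    rw [length_factorAt] at hp
    rw [getElem_factorAt, h p hp, List.getElem_replicate]
  have hsmod := hv.mod_eq_of_ne_zero (i := s) (by rw [hs]; exact hv.neg_one_ne_zero)
  obtain ⟨r, rfl⟩ : ∃ r, s = r + 1 := by
    refine Nat.exists_eq_add_one_of_ne_zero ?_
    rintro rfl
    rw [Nat.zero_mod] at hsmod
    omega
  have hr0 : v r = 0 := by
    by_contra h
    rw [hv.apply_succ_eq_zero h] at hs
    exact hv.neg_one_ne_zero hs.symm
  have hlen : (List.replicate (2 * b - 2) (0 : ZMod q)).length = 2 * b - 2 := by simp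
  refine ⟨hv.replicate_zero_mem_factors_iff.mpr (by omega), ⟨0, ?_, 1, ?_, hv.one_ne_zero.symm⟩,
    ⟨0, ?_, 1, ?_, hv.one_ne_zero.symm⟩⟩
  · rw [mem_leftExtensions_iff]
    refine ⟨b * (r + 1), hzero _ 0 hs (by omega), ?_⟩
    rw [hlen]
    exact word _ fun p hp => by rw [add_assoc]; exact hzero _ _ hs (by omega)
  · rw [mem_leftExtensions_iff]
    refine ⟨b * r + (b - 1), by rw [hv.apply_last, hr0, zero_add], ?_⟩
    rw [hlen]
    refine word _ fun p hp => ?_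
    rw [show b * r + (b - 1) + 1 + p = b * (r + 1) + p by rw [Nat.mul_add]; omega]
    exact hzero _ _ hs (by omega)
  · rw [mem_rightExtensions_iff, hlen]
    exact ⟨b * (r + 1), word _ fun p hp => hzero _ _ hs (by omega), hzero _ _ hs (by omega)⟩
  · rw [mem_rightExtensions_iff, hlen]
    refine ⟨b * (r + 1) + 1, word _ fun p hp => ?_, ?_⟩
    · rw [add_assoc]
      exact hzero _ _ hs (by omega)
    · rw [show b * (r + 1) + 1 + (2 * b - 2) = b * (r + 1 + 1) + (b - 1) by
        rw [Nat.mul_add b (r + 1)]; omega, hv.apply_last, hs0, zero_add]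

theorem length_bispecial_step (hv : IsRulerWord b q v) (l : ℕ) :
    (2 * b - 1) * b ^ (l + 1) - 1 = b * ((2 * b - 1) * b ^ l - 1) + (b - 1) := by
  have hb := hv.two_le_base
  have hpos : 0 < (2 * b - 1) * b ^ l := Nat.mul_pos (by omega) (Nat.pow_pos (by omega))
  rw [pow_succ, ← mul_assoc, mul_comm _ b]
  obtain ⟨c, hc⟩ := Nat.exists_eq_add_one_of_ne_zero hpos.ne'
  rw [hc, Nat.mul_add, Nat.add_sub_cancel]
  omega

/-- These lengths are the orbit of $2b-2$ under $k\mapsto bk+b-1$, which multiplies $k+1$ by $b$.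
Along it the unique bispecial factor is expanded, and expansion commutes with reversal. -/
theorem exists_palindromic_bispecial (hv : IsRulerWord b q v) (l : ℕ) :
    ∃ w, bispecialFactors v ((2 * b - 1) * b ^ l - 1) = {w} ∧ w.reverse = w := by
  have hb := hv.two_le_base
  induction l with
  | zero =>
    refine ⟨List.replicate (2 * b - 2) 0, ?_, List.reverse_replicate⟩
    rw [pow_zero, mul_one, ← hv.bispecialFactors_two_mul_sub_two]
    congr 1
  | succ l ih =>
    obtain ⟨w, hw, hr⟩ := ih
    have hpos : 2 ≤ (2 * b - 1) * b ^ l :=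
      (show 2 ≤ 2 * b - 1 by omega).trans (Nat.le_mul_of_pos_right _ (Nat.pow_pos (by omega)))
    rw [hv.length_bispecial_step]
    have hmem : w ∈ bispecialFactors v ((2 * b - 1) * b ^ l - 1) := hw ▸ rfl
    refine ⟨_, by rw [hv.bispecialFactors_block_eq (by omega), hw, Set.image_singleton], ?_⟩
    rw [reverse_expand hb _ hmem.1.2, hr]

theorem complexity_succ_bispecial (hv : IsRulerWord b q v) (l : ℕ) :
    complexity v ((2 * b - 1) * b ^ l) = complexity v ((2 * b - 1) * b ^ l - 1) + q := by
  have hb := hv.two_le_base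
  induction l with
  | zero =>
    have := hv.complexity_succ_of_le_of_le (n := 2 * b - 2) (by omega) le_rfl
    rw [show 2 * b - 2 + 1 = 2 * b - 1 by omega] at this
    rw [pow_zero, mul_one, this]
    congr 2
  | succ l ih =>
    have hpos : 2 ≤ (2 * b - 1) * b ^ l :=
      (show 2 ≤ 2 * b - 1 by omega).trans (Nat.le_mul_of_pos_right _ (Nat.pow_pos (by omega)))
    have hpos' : 0 < (2 * b - 1) * b ^ (l + 1) := Nat.mul_pos (by omega) (Nat.pow_pos (by omega))
    have e := hv.length_bispecial_step l
    have e' : (2 * b - 1) * b ^ (l + 1) = b * ((2 * b - 1) * b ^ l - 1) + (b - 1) + 1 := by omega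
    have hbk := Nat.le_mul_of_pos_right b (show 0 < (2 * b - 1) * b ^ l - 1 by omega)
    have h := hv.complexity_succ_of_ge (n := b * ((2 * b - 1) * b ^ l - 1) + (b - 1)) (by omega)
    have hd := hv.div_block ((2 * b - 1) * b ^ l - 1)
    rw [zero_add] at hd
    rw [hd, Nat.sub_add_cancel (by omega), ih] at h
    rw [e', Nat.add_sub_cancel]
    omega

end IsRulerWord

/-! ### Frequencies of the factors of the ruler word -/

/-- `ρ` assigns to each word the uniform density of its occurrences in `v`. -/
def IsDensity {A : Type*} (v : ℕ → A) (ρ : List A → ℝ) : Prop :=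
  ∀ z, HasMean ((positions v z).indicator 1) (ρ z)

namespace IsRulerWord

variable {b q : ℕ} {v : ℕ → ZMod q} {ρ : List (ZMod q) → ℝ}

/-- By synchronization the occurrences of the expanded word are exactly $bi+j$ with $i$ an
occurrence of `z`. -/
theorem density_expand (hv : IsRulerWord b q v) (hρ : IsDensity v ρ) {j n : ℕ} (hj : j < b)
    {z : List (ZMod q)} (hz : z ∈ factors v ((j + n) / b))
    (h0 : expand b j n z ≠ List.replicate n 0 ∨ 2 * b - 1 ≤ n) :
    ρ (expand b j n z) = ρ z / b := by
  have h := (hρ z).dilate hj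
  have e : {i | i % b = j ∧ i / b ∈ positions v z} = positions v (expand b j n z) := by
    ext i
    simp only [positions, Set.mem_ofPred_eq, length_expand]
    rw [hv.factorAt_eq_expand_iff hj hz h0, hz.2]
  rw [e] at h
  exact (hρ _).unique h

theorem mem_positions_singleton {A : Type*} {v : ℕ → A} {i : ℕ} {c : A} :
    i ∈ positions v [c] ↔ v i = c := by
  simp [positions, factorAt]

theorem density_singleton_succ (hv : IsRulerWord b q v) (hρ : IsDensity v ρ) {c : ZMod q}
    (hc : c ≠ -1) : ρ [c + 1] = ρ [c] / b := by
  have hb := hv.two_le_base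
  have hk : (b - 1 + 1) / b = 1 := by
    rw [Nat.sub_add_cancel (by omega), Nat.div_self (by omega)]
  have hz : [c] ∈ factors v ((b - 1 + 1) / b) := by
    rw [hk]
    exact hv.singleton_mem_factors c
  have e : expand b (b - 1) 1 [c] = [c + 1] := by
    simp [expand, Nat.mod_eq_of_lt (show b - 1 < b by omega),
      Nat.div_eq_of_lt (show b - 1 < b by omega)]
  rw [← e]
  refine hv.density_expand hρ (by omega) hz (Or.inl ?_)
  rw [e]
  intro h
  exact hc (eq_neg_of_add_eq_zero_left (by simpa using h))

theorem density_singleton_natCast (hv : IsRulerWord b q v) (hρ : IsDensity v ρ) {k : ℕ}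
    (hk : k < q) : ρ [(k : ZMod q)] = ρ [0] / b ^ k := by
  have := hv.neZero
  induction k with
  | zero => simp
  | succ k ih =>
    have hne : (k : ZMod q) ≠ -1 := by
      intro h
      have h1 : ((k + 1 : ℕ) : ZMod q) = 0 := by push_cast; rw [h, neg_add_cancel]
      rw [ZMod.natCast_eq_zero_iff] at h1
      exact absurd (Nat.le_of_dvd (by omega) h1) (by omega)
    rw [Nat.cast_succ, hv.density_singleton_succ hρ hne, ih (by omega), pow_succ, div_div]

theorem density_singleton_sum (_hv : IsRulerWord b q v) (hρ : IsDensity v ρ) (s : Fintype (ZMod q)) :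
    ∑ c : ZMod q, ρ [c] = 1 := by
  have h := HasMean.sum Finset.univ fun c (_ : c ∈ Finset.univ) => hρ [c]
  have e : ∑ c : ZMod q, (positions v [c]).indicator (1 : ℕ → ℝ) = 1 := by
    classical
    ext i
    simp [Finset.sum_apply, Set.indicator_apply, mem_positions_singleton]
  rw [e] at h
  exact h.unique hasMean_one

theorem density_zero_pos (hv : IsRulerWord b q v) (hρ : IsDensity v ρ) : 0 < ρ [0] := by
  have := hv.neZero
  have hb := hv.two_le_base
  have hb' : (0 : ℝ) < b := by exact_mod_cast (by omega : 0 < b)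
  by_contra! h
  have hs := hv.density_singleton_sum hρ inferInstance
  have : ∑ c : ZMod q, ρ [c] ≤ 0 := by
    refine Finset.sum_nonpos fun c _ => ?_
    rw [← ZMod.natCast_zmod_val c, hv.density_singleton_natCast hρ (ZMod.val_lt c)]
    exact div_nonpos_of_nonpos_of_nonneg h (by positivity)
  linarith

/-- Letter densities form a geometric progression of ratio $1/b$ along $0,1,\dots,q-1$. Recognizing
$0$ by its density later determines the symmetries. -/
theorem eq_zero_of_density_eq (hv : IsRulerWord b q v) (hρ : IsDensity v ρ) {c : ZMod q}
    (h : ρ [c] = ρ [0]) : c = 0 := by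
  have := hv.neZero
  have hb := hv.two_le_base
  have hb' : (1 : ℝ) < b := by exact_mod_cast (by omega : 1 < b)
  have hpos := hv.density_zero_pos hρ
  rw [← ZMod.natCast_zmod_val c, hv.density_singleton_natCast hρ (ZMod.val_lt c),
    div_eq_iff (by positivity)] at h
  by_contra hc
  have hv0 : c.val ≠ 0 := fun h => hc ((ZMod.val_eq_zero c).mp h)
  have := one_lt_pow₀ hb' hv0
  nlinarith

theorem density_of_ne_replicate (hv : IsRulerWord b q v) (hρ : IsDensity v ρ) {n : ℕ}
    {w : List (ZMod q)} (hw : w ∈ factors v n)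
    (h0 : w ≠ List.replicate n 0 ∨ 2 * b - 1 ≤ n) :
    ∃ j < b, ∃ z ∈ factors v ((j + n) / b), (w ≠ List.replicate n 0 →
      z ≠ List.replicate ((j + n) / b) (-1)) ∧ ρ w = ρ z / b := by
  obtain ⟨j, hj, z, hz, rfl⟩ := hv.exists_eq_expand hw
  exact ⟨j, hj, z, hz, fun hne h =>
    hne ((expand_eq_replicate_zero_iff hv.two_le_base hj hz.2).mpr h), hv.density_expand hρ hj hz h0⟩

/-- A window of length at most $b$ contains at most one block end, so a nonzero factor comes from a
single letter $c\ne-1$ and has density $\rho[c]/b=\rho[c+1]$. -/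
theorem density_mem_of_le_base (hv : IsRulerWord b q v) (hρ : IsDensity v ρ) {n : ℕ}
    (hn : n ≤ b) {w : List (ZMod q)} (hw : w ∈ factors v n) (h0 : w ≠ List.replicate n 0) :
    ρ w ∈ (fun c => ρ [c]) '' {0}ᶜ := by
  have hb := hv.two_le_base
  obtain ⟨j, hj, z, hz, hne, e⟩ := hv.density_of_ne_replicate hρ hw (Or.inl h0)
  have hne := hne h0
  have hk : (j + n) / b < 2 := (Nat.div_lt_iff_lt_mul (by omega)).mpr (by omega)
  interval_cases hjn : (j + n) / b
  · exact absurd (mem_factors_zero_iff.mp hz) hne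
  · obtain ⟨c, rfl⟩ := hv.mem_factors_one_iff.mp hz
    have hc : c ≠ -1 := fun h => hne (by rw [h]; rfl)
    exact ⟨c + 1, fun h => hc (eq_neg_of_add_eq_zero_left h),
      (hv.density_singleton_succ hρ hc).trans e.symm⟩

/-- Up to two block ends are visible. A preimage of length $2$ is $00$ or has the density of a
nonzero letter; only $00$ and the density of $-1$ can give new values. -/
theorem density_mem_of_lt_two_mul (hv : IsRulerWord b q v) (hρ : IsDensity v ρ) {n : ℕ}
    (hn : n ≤ 2 * b - 1) {w : List (ZMod q)} (hw : w ∈ factors v n)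
    (h0 : w ≠ List.replicate n 0) :
    ρ w ∈ insert (ρ [0, 0] / b) (insert (ρ [-1] / b) ((fun c => ρ [c]) '' {0}ᶜ)) := by
  have hb := hv.two_le_base
  obtain ⟨j, hj, z, hz, hne, e⟩ := hv.density_of_ne_replicate hρ hw (Or.inl h0)
  have hne := hne h0
  have step : ∀ c, c ≠ -1 → ρ [c] / b ∈ (fun c => ρ [c]) '' {0}ᶜ := fun c hc =>
    ⟨c + 1, fun h => hc (eq_neg_of_add_eq_zero_left h), hv.density_singleton_succ hρ hc⟩
  have hk : (j + n) / b < 3 := (Nat.div_lt_iff_lt_mul (by omega)).mpr (by omega)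
  rw [e]
  interval_cases hjn : (j + n) / b
  · exact absurd (mem_factors_zero_iff.mp hz) hne
  · obtain ⟨c, rfl⟩ := hv.mem_factors_one_iff.mp hz
    exact Or.inr (Or.inr (step c fun h => hne (by rw [h]; rfl)))
  · by_cases hz0 : z = List.replicate 2 0
    · subst hz0
      exact Or.inl rfl
    · obtain ⟨c, hc, hcz⟩ := hv.density_mem_of_le_base hρ hb hz hz0
      rw [← hcz]
      by_cases hc1 : c = -1
      · exact Or.inr (Or.inl (by rw [hc1]))
      · exact Or.inr (Or.inr (step c hc1))

theorem image_density_subset_of_ge (hv : IsRulerWord b q v) (hρ : IsDensity v ρ) {n : ℕ}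
    (hn : 2 * b - 1 ≤ n) : ρ '' factors v n ⊆
      (· / (b : ℝ)) '' (ρ '' factors v (n / b) ∪ ρ '' factors v (n / b + 1)) := by
  have hb := hv.two_le_base
  rintro _ ⟨w, hw, rfl⟩
  obtain ⟨j, hj, z, hz, -, e⟩ := hv.density_of_ne_replicate hρ hw (Or.inr hn)
  refine ⟨ρ z, ?_, e.symm⟩
  have h1 : n / b ≤ (j + n) / b := Nat.div_le_div_right (by omega)
  have h2 : (j + n) / b ≤ n / b + 1 := by
    rw [← Nat.add_div_left n (show 0 < b by omega)]
    exact Nat.div_le_div_right (by omega)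
  rcases (show (j + n) / b = n / b ∨ (j + n) / b = n / b + 1 by omega) with h | h
  · exact Or.inl ⟨z, h ▸ hz, rfl⟩
  · exact Or.inr ⟨z, h ▸ hz, rfl⟩

/-- For lengths divisible by $b$ all residues see the same number of block ends, so a single
preimage length is involved. -/
theorem image_density_mul (hv : IsRulerWord b q v) (hρ : IsDensity v ρ) {n : ℕ} (hn : 2 ≤ n) :
    ρ '' factors v (b * n) = (· / (b : ℝ)) '' (ρ '' factors v n) := by
  have hb := hv.two_le_base
  have hbn : 2 * b - 1 ≤ b * n := (Nat.sub_le _ _).trans (by rw [mul_comm]; gcongr)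
  have hd : ∀ j < b, (j + b * n) / b = n := fun j hj => by
    rw [Nat.add_mul_div_left _ _ (by omega), Nat.div_eq_of_lt hj, zero_add]
  ext r
  constructor
  · rintro ⟨w, hw, rfl⟩
    obtain ⟨j, hj, z, hz, -, e⟩ := hv.density_of_ne_replicate hρ hw (Or.inr hbn)
    rw [hd j hj] at hz
    exact ⟨ρ z, ⟨z, hz, rfl⟩, e.symm⟩
  · rintro ⟨_, ⟨z, hz, rfl⟩, rfl⟩
    rw [← hd 0 (by omega)] at hz
    exact ⟨_, hv.expand_mem_factors 0 _ hz, hv.density_expand hρ (by omega) hz (Or.inr hbn)⟩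

theorem ncard_image_density_singleton_le (hv : IsRulerWord b q v) (ρ : List (ZMod q) → ℝ) :
    ((fun c : ZMod q => ρ [c]) '' {0}ᶜ).ncard ≤ q - 1 := by
  have := hv.neZero
  refine (Set.ncard_image_le (Set.toFinite _)).trans ?_
  rw [Set.ncard_compl, Set.ncard_singleton, Nat.card_zmod]

/-- Factors of two consecutive lengths have few frequencies. -/
theorem ncard_density_union_lt (hv : IsRulerWord b q v) (hρ : IsDensity v ρ) (hq : 2 < q) {k : ℕ}
    (hk : 1 ≤ k) : (ρ '' factors v k ∪ ρ '' factors v (k + 1)).ncard + 2 * complexity v k <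
      1 + 2 * complexity v (k + 1) := by
  have hb := hv.two_le_base
  have := hv.neZero
  have hS := hv.ncard_image_density_singleton_le ρ
  set S := (fun c : ZMod q => ρ [c]) '' {0}ᶜ with hSdef
  have hSfin : S.Finite := Set.toFinite _
  induction k using Nat.strong_induction_on with
  | _ k ih =>
    rcases lt_or_ge k b with h1 | h1
    -- At most $q-1$ values plus two zero words: $q+1<1+2(q-1)$ because $q>2$.
    · have hsub : ρ '' factors v k ∪ ρ '' factors v (k + 1) ⊆
          insert (ρ (List.replicate k 0)) (insert (ρ (List.replicate (k + 1) 0)) S) := by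
        rintro _ (⟨w, hw, rfl⟩ | ⟨w, hw, rfl⟩)
        · by_cases h0 : w = List.replicate k 0
          · exact Or.inl (by rw [h0])
          · exact Or.inr (Or.inr (hv.density_mem_of_le_base hρ h1.le hw h0))
        · by_cases h0 : w = List.replicate (k + 1) 0
          · exact Or.inr (Or.inl (by rw [h0]))
          · exact Or.inr (Or.inr (hv.density_mem_of_le_base hρ h1 hw h0))
      have c1 := Set.ncard_le_ncard hsub ((hSfin.insert _).insert _)
      have c2 := Set.ncard_insert_le (ρ (List.replicate k 0))
        (insert (ρ (List.replicate (k + 1) 0)) S)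
      have c3 := Set.ncard_insert_le (ρ (List.replicate (k + 1) 0)) S
      have := hv.complexity_succ_of_lt h1
      omega
    rcases le_or_gt k (2 * b - 2) with h2 | h2
    -- Two more values than before, and the increment is now $q$: $q+3<1+2q$ because $q>2$.
    · set R := insert (ρ [0, 0] / b) (insert (ρ [-1] / b) S) with hR
      have hRfin : R.Finite := (hSfin.insert _).insert _
      have hsub : ρ '' factors v k ∪ ρ '' factors v (k + 1) ⊆
          insert (ρ (List.replicate k 0)) (insert (ρ (List.replicate (k + 1) 0)) R) := by
        rintro _ (⟨w, hw, rfl⟩ | ⟨w, hw, rfl⟩)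
        · by_cases h0 : w = List.replicate k 0
          · exact Or.inl (by rw [h0])
          · exact Or.inr (Or.inr (hv.density_mem_of_lt_two_mul hρ (by omega) hw h0))
        · by_cases h0 : w = List.replicate (k + 1) 0
          · exact Or.inr (Or.inl (by rw [h0]))
          · exact Or.inr (Or.inr (hv.density_mem_of_lt_two_mul hρ (by omega) hw h0))
      have c1 := Set.ncard_le_ncard hsub ((hRfin.insert _).insert _)
      have c2 := Set.ncard_insert_le (ρ (List.replicate k 0))
        (insert (ρ (List.replicate (k + 1) 0)) R)
      have c3 := Set.ncard_insert_le (ρ (List.replicate (k + 1) 0)) R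
      have c4 := Set.ncard_insert_le (ρ [0, 0] / b) (insert (ρ [-1] / b) S)
      have c5 := Set.ncard_insert_le (ρ [-1] / b) S
      rw [← hR] at c4
      have := hv.complexity_succ_of_le_of_le h1 h2
      omega
    · have hd1 : 1 ≤ k / b := (Nat.le_div_iff_mul_le (by omega)).mpr (by omega)
      -- Either both lengths have the same quotient, or $k+1$ is divisible by $b$ and uses only the
      -- preimage length $k/b+1$. In both cases the preimage lengths stay within the same
      -- consecutive pair.
      have hd2 : (k + 1) / b = k / b ∨ (k + 1) / b = k / b + 1 ∧ b ∣ k + 1 := by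
        rw [Nat.succ_div]
        split_ifs with h
        · exact Or.inr ⟨rfl, h⟩
        · exact Or.inl rfl
      have hsub : ρ '' factors v k ∪ ρ '' factors v (k + 1) ⊆
          (· / (b : ℝ)) '' (ρ '' factors v (k / b) ∪ ρ '' factors v (k / b + 1)) := by
        refine Set.union_subset (hv.image_density_subset_of_ge hρ (by omega)) ?_
        rcases hd2 with hd2 | ⟨hd2, c, hc⟩
        · rw [← hd2]
          exact hv.image_density_subset_of_ge hρ (by omega)
        · have hcc : k / b + 1 = c := by
            rw [← hd2, hc, Nat.mul_div_cancel_left _ (by omega)]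
          rw [hc, hv.image_density_mul hρ (by omega), hcc]
          exact Set.image_mono Set.subset_union_right
      have hfin : (ρ '' factors v (k / b) ∪ ρ '' factors v (k / b + 1)).Finite :=
        ((hv.finite_factors _).image _).union ((hv.finite_factors _).image _)
      have c1 := Set.ncard_le_ncard hsub (hfin.image _)
      have c2 := Set.ncard_image_le (f := (· / (b : ℝ))) hfin
      have c3 := ih (k / b) (Nat.div_lt_self (by omega) (by omega)) hd1
      have := hv.complexity_succ_of_ge (n := k) (by omega)
      omega

/-- The strict inequality behind the case $q>2$. The base lengths give $q+1<2q-1$ and $q+3<2q+1$,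
now counting one bispecial factor instead of a second zero word. -/
theorem ncard_density_add_lt (hv : IsRulerWord b q v) (hρ : IsDensity v ρ) (hq : 2 < q) (n : ℕ) :
    (ρ '' factors v (n + 1)).ncard + (bispecialFactors v n).ncard + 2 * complexity v n <
      1 + 2 * complexity v (n + 1) := by
  have hb := hv.two_le_base
  have := hv.neZero
  have hS := hv.ncard_image_density_singleton_le ρ
  set S := (fun c : ZMod q => ρ [c]) '' {0}ᶜ with hSdef
  have hSfin : S.Finite := Set.toFinite _
  induction n using Nat.strong_induction_on with
  | _ n ih =>
    rcases le_or_gt n (2 * b - 2) with h2 | h2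
    · have hX := hv.ncard_bispecialFactors_le_one h2
      rcases lt_or_ge n b with h1 | h1
      · have hsub : ρ '' factors v (n + 1) ⊆ insert (ρ (List.replicate (n + 1) 0)) S := by
          rintro _ ⟨w, hw, rfl⟩
          by_cases h0 : w = List.replicate (n + 1) 0
          · exact Or.inl (by rw [h0])
          · exact Or.inr (hv.density_mem_of_le_base hρ h1 hw h0)
        have c1 := Set.ncard_le_ncard hsub (hSfin.insert _)
        have c2 := Set.ncard_insert_le (ρ (List.replicate (n + 1) 0)) S
        have := hv.complexity_succ_of_lt h1
        omega
      · set R := insert (ρ [0, 0] / b) (insert (ρ [-1] / b) S) with hR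
        have hRfin : R.Finite := (hSfin.insert _).insert _
        have hsub : ρ '' factors v (n + 1) ⊆ insert (ρ (List.replicate (n + 1) 0)) R := by
          rintro _ ⟨w, hw, rfl⟩
          by_cases h0 : w = List.replicate (n + 1) 0
          · exact Or.inl (by rw [h0])
          · exact Or.inr (hv.density_mem_of_lt_two_mul hρ (by omega) hw h0)
        have c1 := Set.ncard_le_ncard hsub (hRfin.insert _)
        have c2 := Set.ncard_insert_le (ρ (List.replicate (n + 1) 0)) R
        have c4 := Set.ncard_insert_le (ρ [0, 0] / b) (insert (ρ [-1] / b) S)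
        have c5 := Set.ncard_insert_le (ρ [-1] / b) S
        rw [← hR] at c4
        have := hv.complexity_succ_of_le_of_le h1 h2
        omega
    · have hC := hv.complexity_succ_of_ge (n := n) (by omega)
      have hd1 : 1 ≤ n / b := (Nat.le_div_iff_mul_le (by omega)).mpr (by omega)
      by_cases hdvd : b ∣ n + 1
      -- When $b\mid n+1$ bispecial factors survive, but the frequencies come from one preimage
      -- length and the claim for $k$ transfers. Otherwise there are no bispecial factors, which
      -- leaves room for two preimage lengths.
      · obtain ⟨c, hc⟩ := hdvd
        obtain ⟨k, rfl⟩ : ∃ k, c = k + 1 :=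
          Nat.exists_eq_add_one_of_ne_zero (by rintro rfl; omega)
        have hn : n = b * k + (b - 1) := by rw [Nat.mul_add] at hc; omega
        have hnk : n / b = k := by
          have := hv.div_block k
          rwa [zero_add, ← hn] at this
        rw [hnk] at hC hd1
        have hkn : k < n := by
          rw [← hnk]
          exact Nat.div_lt_self (by omega) (by omega)
        have c1 := ih k hkn
        have c2 : (ρ '' factors v (n + 1)).ncard ≤ (ρ '' factors v (k + 1)).ncard := by
          rw [hc, hv.image_density_mul hρ (by omega)]
          exact Set.ncard_image_le ((hv.finite_factors _).image _)
        have c3 := hv.ncard_bispecialFactors_block_le hd1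
        rw [← hn] at c3
        omega
      · have hX := hv.ncard_bispecialFactors_eq_zero (by omega) hdvd
        have hd2 : (n + 1) / b = n / b := by rw [Nat.succ_div, if_neg hdvd, add_zero]
        have hsub := hv.image_density_subset_of_ge hρ (n := n + 1) (by omega)
        rw [hd2] at hsub
        have hfin : (ρ '' factors v (n / b) ∪ ρ '' factors v (n / b + 1)).Finite :=
          ((hv.finite_factors _).image _).union ((hv.finite_factors _).image _)
        have c1 := Set.ncard_le_ncard hsub (hfin.image _)
        have c2 := Set.ncard_image_le (f := (· / (b : ℝ))) hfin
        have c3 := hv.ncard_density_union_lt hρ hq hd1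
        omega

/-! ### The binary ruler word -/

/-- The densities of $0$ and $1$ have ratio $b$ and sum $1$; moreover $01$ is read from the block of
$0$, and $\rho[0]=\rho[00]+\rho[01]$. -/
theorem density_of_modulus_two {v : ℕ → ZMod 2} {ρ : List (ZMod 2) → ℝ}
    (hv : IsRulerWord b 2 v) (hρ : IsDensity v ρ) :
    ρ [1] = 1 / (b + 1) ∧ ρ [0, 0] = (b - 1) / (b + 1) := by
  have hb := hv.two_le_base
  have hb' : (0 : ℝ) < b := by exact_mod_cast (by omega : 0 < b)
  have hs := hv.density_singleton_sum hρ inferInstance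
  have h1 : ρ [1] = ρ [0] / b := by
    have := hv.density_singleton_succ hρ (c := 0) (by decide)
    rwa [zero_add] at this
  have hs' : ρ [0] + ρ [1] = 1 := by
    rw [← hs]
    exact (Fin.sum_univ_two (fun c : ZMod 2 => ρ [c])).symm
  have h01 : ρ [0, 1] = ρ [0] / b := by
    have hk : (b - 2 + 2) / b = 1 := by
      rw [Nat.sub_add_cancel hb, Nat.div_self (by omega)]
    have e : expand b (b - 2) 2 [(0 : ZMod 2)] = [0, 1] := by
      rw [expand, show List.range 2 = [0, 1] from rfl]
      simp only [List.map_cons, List.map_nil, add_zero]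
      rw [Nat.mod_eq_of_lt (by omega), if_neg (by omega), show b - 2 + 1 = b - 1 by omega,
        Nat.mod_eq_of_lt (by omega), if_pos rfl, Nat.div_eq_of_lt (by omega)]
      rfl
    rw [← e]
    refine hv.density_expand hρ (by omega) ?_ (Or.inl ?_)
    · rw [hk]
      exact hv.singleton_mem_factors 0
    · rw [e]
      decide
  have h00 : ρ [0] = ρ [0, 0] + ρ [0, 1] := by
    refine (hρ [0]).unique ?_
    have := (hρ [0, 0]).add (hρ [0, 1])
    convert this using 1
    ext i
    classical
    simp only [Pi.add_apply, Set.indicator_apply, positions, Set.mem_ofPred_eq, List.length_cons,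
      List.length_nil, zero_add, Nat.reduceAdd, factorAt_succ, Pi.one_apply]
    generalize v i = x
    generalize v (i + 1) = y
    have hnil : ∀ i, factorAt v i 0 = [] := fun _ => rfl
    simp only [hnil]
    have hy : y = 0 ∨ y = 1 := by revert y; decide
    have h10 : (1 : ZMod 2) ≠ 0 := by decide
    rcases hy with rfl | rfl <;> by_cases hx : x = 0 <;> simp [hx, h10, h10.symm]
  have e1 : ρ [1] = 1 / (b + 1) := by
    rw [eq_div_iff (by positivity)] at h1
    rw [eq_div_iff (by positivity)]
    linarith
  refine ⟨e1, ?_⟩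
  rw [← h1, e1] at h01
  have : ρ [0] = 1 - 1 / (b + 1) := by linarith
  have h2 : ρ [0, 0] = 1 - 1 / (b + 1) - 1 / (b + 1) := by linarith
  rw [h2]
  field_simp
  ring

theorem image_density_of_modulus_two {v : ℕ → ZMod 2} {ρ : List (ZMod 2) → ℝ}
    (hv : IsRulerWord b 2 v) (hρ : IsDensity v ρ) :
    ρ '' factors v (2 * b - 1) = {ρ [0, 0] / b, ρ [1] / b, ρ [1]} := by
  have hb := hv.two_le_base
  have hS : (fun c : ZMod 2 => ρ [c]) '' {0}ᶜ ⊆ {ρ [1]} := by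
    rintro _ ⟨c, hc, rfl⟩
    fin_cases c
    · exact absurd rfl hc
    · rfl
  have hk : (0 + (2 * b - 1)) / b = 1 := Nat.div_eq_of_lt_le (by omega) (by omega)
  have hmem : ∀ c : ZMod 2, ρ [c] / b ∈ ρ '' factors v (2 * b - 1) := by
    intro c
    have hc : [c] ∈ factors v ((0 + (2 * b - 1)) / b) := by
      rw [hk]
      exact hv.singleton_mem_factors c
    exact ⟨_, hv.expand_mem_factors 0 _ hc, hv.density_expand hρ (by omega) hc (Or.inr le_rfl)⟩
  refine Set.Subset.antisymm ?_ ?_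
  · rintro _ ⟨w, hw, rfl⟩
    by_cases h0 : w = List.replicate (2 * b - 1) 0
    · have e := expand_replicate_neg_one (q := 2) (j := 0) (n := 2 * b - 1) hb
      have hc : List.replicate ((0 + (2 * b - 1)) / b) (-1 : ZMod 2) ∈
          factors v ((0 + (2 * b - 1)) / b) := by
        rw [hk]
        exact hv.singleton_mem_factors _
      have := hv.density_expand hρ (by omega) hc (Or.inr le_rfl)
      rw [e, hk] at this
      rw [h0, this]
      exact Or.inr (Or.inl rfl)
    · rcases hv.density_mem_of_lt_two_mul hρ le_rfl hw h0 with h | h | h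
      · exact Or.inl h
      · exact Or.inr (Or.inl h)
      · exact Or.inr (Or.inr (hS h))
  · rintro _ (rfl | rfl | rfl)
    · have hk2 : (1 + (2 * b - 1)) / b = 2 := by
        rw [show 1 + (2 * b - 1) = 2 * b by omega, Nat.mul_div_cancel _ (by omega)]
      have hc : [0, 0] ∈ factors v ((1 + (2 * b - 1)) / b) := by
        rw [hk2]
        exact hv.replicate_zero_mem_factors_iff (n := 2).mpr (by omega)
      exact ⟨_, hv.expand_mem_factors 1 _ hc, hv.density_expand hρ (by omega) hc (Or.inr le_rfl)⟩
    · exact hmem 1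
    · have := hv.density_singleton_succ hρ (c := 0) (by decide)
      rw [zero_add] at this
      rw [this]
      exact hmem 0

/-- At length $2b-1$ the values are $(b-1)/(b(b+1))$, $1/(b(b+1))$ and $1/(b+1)$; multiplying the
length by $b$ divides every value by $b$. -/
theorem ncard_density_of_modulus_two {v : ℕ → ZMod 2} {ρ : List (ZMod 2) → ℝ}
    (hv : IsRulerWord b 2 v) (hρ : IsDensity v ρ) (l : ℕ) :
    (ρ '' factors v ((2 * b - 1) * b ^ l)).ncard = if b = 2 then 2 else 3 := by
  have hb := hv.two_le_base
  have hb' : (0 : ℝ) < b := by exact_mod_cast (by omega : 0 < b)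
  induction l with
  | zero =>
    obtain ⟨e1, e2⟩ := hv.density_of_modulus_two hρ
    rw [pow_zero, mul_one, hv.image_density_of_modulus_two hρ, e1, e2]
    have hb2 : (2 : ℝ) ≤ b := by exact_mod_cast hb
    have d1 : 1 / ((b : ℝ) + 1) / b ≠ 1 / (b + 1) := by
      rw [Ne, div_div, div_eq_div_iff (by positivity) (by positivity)]
      nlinarith
    have d2 : ((b : ℝ) - 1) / (b + 1) / b ≠ 1 / (b + 1) := by
      rw [Ne, div_div, div_eq_div_iff (by positivity) (by positivity)]
      nlinarith
    split_ifs with h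
    · have : ((b : ℝ) - 1) = 1 := by rw [h]; norm_num
      rw [this, Set.insert_eq_of_mem (Set.mem_insert _ _), Set.ncard_pair d1]
    · have d3 : ((b : ℝ) - 1) / (b + 1) / b ≠ 1 / (b + 1) / b := by
        have : (2 : ℝ) ≠ b := by exact_mod_cast Ne.symm h
        rw [Ne, div_left_inj' hb'.ne', div_left_inj' (by positivity)]
        intro h
        exact this (by linarith)
      rw [Set.ncard_insert_of_notMem, Set.ncard_pair d1]
      rintro (h | h)
      · exact d3 h
      · exact d2 h
  | succ l ih =>
    have hpos : 2 ≤ (2 * b - 1) * b ^ l :=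
      (show 2 ≤ 2 * b - 1 by omega).trans (Nat.le_mul_of_pos_right _ (Nat.pow_pos (by omega)))
    rw [← ih, pow_succ, ← mul_assoc, mul_comm _ b, hv.image_density_mul hρ hpos]
    exact Set.ncard_image_of_injective _ fun x y h => (div_left_inj' hb'.ne').mp h

end IsRulerWord

/-! ### The generalized Thue-Morse word as a lift of the ruler word -/

/-- The word starting in `x` whose differences of successive letters are `1 - κ c`, where `c` runs
through the letters of `z`. -/
def lift {q m : ℕ} (κ : ZMod q →+ ZMod m) : ZMod m → List (ZMod q) → List (ZMod m)
  | x, [] => [x]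
  | x, c :: z => x :: lift κ (x + (1 - κ c)) z

section Lift

variable {q m : ℕ} {κ : ZMod q →+ ZMod m}

theorem length_lift (x : ZMod m) (z : List (ZMod q)) : (lift κ x z).length = z.length + 1 := by
  induction z generalizing x with
  | nil => rfl
  | cons c z ih => rw [lift, List.length_cons, ih, List.length_cons]

theorem lift_injective (hκ : Function.Injective κ) {x y : ZMod m} {z z' : List (ZMod q)}
    (h : lift κ x z = lift κ y z') : x = y ∧ z = z' := by
  induction z generalizing x y z' with
  | nil =>
    have hl := congrArg List.length h
    rw [length_lift, length_lift] at hl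
    obtain rfl : z' = [] := List.length_eq_zero_iff.mp (by simpa using hl.symm)
    exact ⟨by simpa [lift] using h, rfl⟩
  | cons c z ih =>
    cases z' with
    | nil =>
      have hl := congrArg List.length h
      rw [length_lift, length_lift] at hl
      simp at hl
    | cons c' z' =>
      rw [lift, lift, List.cons.injEq] at h
      obtain ⟨rfl, h⟩ := h
      obtain ⟨h1, rfl⟩ := ih h
      have : κ c = κ c' := sub_right_injective (add_left_cancel h1)
      rw [hκ this]
      exact ⟨rfl, rfl⟩

theorem map_add_lift (y x : ZMod m) (z : List (ZMod q)) :
    (lift κ x z).map (fun k => y + k) = lift κ (y + x) z := by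
  induction z generalizing x with
  | nil => rfl
  | cons c z ih => rw [lift, List.map_cons, ih, lift, add_assoc]

/-- The total increment along the lift of `z`. -/
def increment (κ : ZMod q →+ ZMod m) (z : List (ZMod q)) : ZMod m :=
  (z.map fun c => 1 - κ c).sum

theorem increment_cons (c : ZMod q) (z : List (ZMod q)) :
    increment κ (c :: z) = (1 - κ c) + increment κ z := by
  simp [increment]

theorem increment_reverse (z : List (ZMod q)) : increment κ z.reverse = increment κ z := by
  simp [increment, List.sum_reverse]

theorem lift_append_singleton (x : ZMod m) (z : List (ZMod q)) (c : ZMod q) :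
    lift κ x (z ++ [c]) = lift κ x z ++ [x + increment κ z + (1 - κ c)] := by
  induction z generalizing x with
  | nil => simp [lift, increment]
  | cons d z ih => rw [List.cons_append, lift, ih, lift, increment_cons, List.cons_append, add_assoc x]

/-- Negation and reversal each change the sign of successive differences, so together they only
reverse the difference word; the new first letter is $y$ minus the old last letter. -/
theorem reflection_lift (y x : ZMod m) (z : List (ZMod q)) :
    reflection y (lift κ x z) = lift κ (y - (x + increment κ z)) z.reverse := by
  have e : ∀ w, reflection y w = (w.map fun k => y - k).reverse := fun _ => rfl
  induction z generalizing x with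
  | nil => simp [e, lift, increment]
  | cons c z ih =>
    simp only [e] at ih ⊢
    rw [lift, List.map_cons, List.reverse_cons, ih, List.reverse_cons, lift_append_singleton,
      increment_reverse, increment_cons]
    congr 2
    · congr 1; ring
    · ring

end Lift

/-- `u` is the generalized Thue-Morse word with parameters `b` and `m`, and `v` the ruler word
encoding its differences of successive letters by way of `κ`. -/
structure IsThueMorseLift (b q m : ℕ) (κ : ZMod q →+ ZMod m) (v : ℕ → ZMod q)
    (u : ℕ → ZMod m) : Prop where
  ruler : IsRulerWord b q v
  injective : Function.Injective κ
  two_le : 2 ≤ m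
  apply_zero : u 0 = 0
  apply_block : ∀ i, ∀ j < b, u (b * i + j) = u i + (j : ZMod m)
  apply_succ : ∀ i, u (i + 1) = u i + (1 - κ (v i))

/-- Each carry in passing from $i$ to $i+1$ replaces a digit $b-1$ by $0$. The definition of $q$
makes $c\mapsto c(b-1)$ well defined on $\mathbb Z_q$, its minimality makes it injective, and
$b\not\equiv1$ gives $q\ge2$. -/
theorem exists_isThueMorseLift {b m : ℕ} (hb : 2 ≤ b) (hm : 1 ≤ m) (hbm : ¬ b ≡ 1 [MOD m])
    {q : ℕ} (hq : IsLeast {k : ℕ | 0 < k ∧ k * (b - 1) ≡ 0 [MOD m]} q)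
    {u : ℕ → ZMod m} (hu : IsGeneralizedThueMorse b m u) :
    ∃ (κ : ZMod q →+ ZMod m) (v : ℕ → ZMod q), IsThueMorseLift b q m κ v u := by
  obtain ⟨⟨hq0, hqm⟩, hmin⟩ := hq
  obtain ⟨hu0, hu⟩ := hu
  rw [isFixedPoint_thueMorse_iff] at hu
  have hq2 : 2 ≤ q := by
    by_contra! h
    obtain rfl : q = 1 := by omega
    rw [one_mul] at hqm
    refine hbm ?_
    have := hqm.add_right 1
    rwa [Nat.sub_add_cancel (by omega), zero_add] at this
  have hm2 : 2 ≤ m := by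
    by_contra! h
    obtain rfl : m = 1 := by omega
    exact hbm (Nat.modEq_one)
  let κ : ZMod q →+ ZMod m := ZMod.lift q ⟨zmultiplesHom (ZMod m) ((b - 1 : ℕ) : ZMod m), by
    have := (ZMod.natCast_eq_natCast_iff _ _ _).mpr hqm
    push_cast at this
    simpa using this⟩
  have hκ : ∀ k : ℕ, κ (k : ZMod q) = k * ((b - 1 : ℕ) : ZMod m) := by
    intro k
    have := ZMod.lift_coe q (⟨zmultiplesHom (ZMod m) ((b - 1 : ℕ) : ZMod m), by
      have := (ZMod.natCast_eq_natCast_iff _ _ _).mpr hqm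
      push_cast at this
      simpa using this⟩ : {f : ℤ →+ ZMod m // f q = 0}) (k : ℤ)
    simpa using this
  have : NeZero q := ⟨by omega⟩
  have hv := isRulerWord_ruler hb hq2
  refine ⟨κ, ruler b q, hv, ?_, hm2, hu0, hu, ?_⟩
  · rw [injective_iff_map_eq_zero]
    intro c hc
    rw [← ZMod.natCast_zmod_val c, hκ] at hc
    by_contra hne
    have h0 : 0 < c.val := Nat.pos_of_ne_zero fun h => hne ((ZMod.val_eq_zero c).mp h)
    have h1 : c.val * (b - 1) ≡ 0 [MOD m] := by
      rw [← ZMod.natCast_eq_natCast_iff]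
      push_cast
      exact hc
    exact absurd (hmin ⟨h0, h1⟩) (by have := ZMod.val_lt c; omega)
  · intro i
    induction i using Nat.strong_induction_on with
    | _ i ih =>
      have e := Nat.div_add_mod i b
      have hl := Nat.mod_lt i (show b > 0 by omega)
      by_cases h : i % b = b - 1
      -- A carry: `i + 1` starts the block following that of `i`, so the difference is the one at `i
      -- / b` minus $b-1$.
      · have hi : i / b < i := Nat.div_lt_self
          (Nat.pos_of_ne_zero (by rintro rfl; rw [Nat.zero_mod] at h; omega)) (by omega)
        have h1 := hu (i / b + 1) 0 (by omega)
        have h2 := hu (i / b) (b - 1) (by omega)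
        rw [show b * (i / b + 1) + 0 = i + 1 by rw [Nat.mul_add]; omega, ih _ hi] at h1
        rw [← h, e] at h2
        have h3 := hκ 1
        rw [Nat.cast_one, Nat.cast_one, one_mul] at h3
        rw [h1, h2, hv.apply_eq i, if_pos h, map_add, h3, h]
        push_cast
        ring
      · have h1 := hu (i / b) (i % b + 1) (by omega)
        have h2 := hu (i / b) (i % b) hl
        rw [← add_assoc, e] at h1
        rw [e] at h2
        rw [h1, h2, hv.apply_eq i, if_neg h, map_zero]
        push_cast
        ring

/-! ### Correspondence between the factors of the lift and those of the ruler word. -/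

namespace IsThueMorseLift

variable {b q m : ℕ} {κ : ZMod q →+ ZMod m} {v : ℕ → ZMod q} {u : ℕ → ZMod m}

theorem neZero (hu : IsThueMorseLift b q m κ v u) : NeZero m := ⟨by have := hu.two_le; omega⟩

theorem factorAt_eq_lift (hu : IsThueMorseLift b q m κ v u) (i n : ℕ) :
    factorAt u i (n + 1) = lift κ (u i) (factorAt v i n) := by
  induction n generalizing i with
  | zero => simp [factorAt, lift]
  | succ n ih => rw [factorAt_succ, ih, factorAt_succ v, lift, hu.apply_succ]

theorem factorAt_eq_lift_iff (hu : IsThueMorseLift b q m κ v u) {i : ℕ} {x : ZMod m}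
    {z : List (ZMod q)} : factorAt u i (z.length + 1) = lift κ x z ↔
      u i = x ∧ factorAt v i z.length = z := by
  rw [hu.factorAt_eq_lift]
  exact ⟨fun h => lift_injective hu.injective h, fun h => by rw [h.1, h.2]⟩

theorem apply_add (hu : IsThueMorseLift b q m κ v u) (i n : ℕ) :
    u (i + n) = u i + increment κ (factorAt v i n) := by
  induction n generalizing i with
  | zero => simp [factorAt, increment]
  | succ n ih =>
    rw [factorAt_succ, increment_cons, ← add_assoc (u i), ← hu.apply_succ, ← ih]
    congr 1
    omega

theorem apply_pow_block (hu : IsThueMorseLift b q m κ v u) (L i r : ℕ) (hr : r < b ^ L) :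
    u (b ^ L * i + r) = u i + u r := by
  have hb := hu.ruler.two_le_base
  induction L generalizing r with
  | zero =>
    obtain rfl : r = 0 := by simpa using hr
    simp [hu.apply_zero]
  | succ L ih =>
    have hl := Nat.mod_lt r (show b > 0 by omega)
    rw [pow_succ] at hr ⊢
    have e : b ^ L * b * i + r = b * (b ^ L * i + r / b) + r % b := by
      conv_lhs => rw [← Nat.div_add_mod r b]
      ring
    rw [e, hu.apply_block _ _ hl, ih _ ((Nat.div_lt_iff_lt_mul (by omega)).mpr hr), add_assoc,
      ← hu.apply_block _ _ hl, Nat.div_add_mod]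

theorem surjective (hu : IsThueMorseLift b q m κ v u) : Function.Surjective u := by
  have := hu.neZero
  have hb := hu.ruler.two_le_base
  have h : ∀ k : ℕ, ∃ i, u i = k := by
    intro k
    induction k with
    | zero => exact ⟨0, by simp [hu.apply_zero]⟩
    | succ k ih =>
      obtain ⟨i, hi⟩ := ih
      exact ⟨b * i + 1, by rw [hu.apply_block _ _ (by omega), hi]; push_cast; ring⟩
  intro x
  obtain ⟨i, hi⟩ := h x.val
  exact ⟨i, by rw [hi, ZMod.natCast_zmod_val]⟩

/-- Each factor of the ruler word occurs at positions of all letters of `u`. -/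
theorem exists_position (hu : IsThueMorseLift b q m κ v u) (x : ZMod m) (i n : ℕ) :
    ∃ i', u i' = x ∧ factorAt v i' n = factorAt v i n := by
  have hb := hu.ruler.two_le_base
  have hL : i + n + 1 < b ^ (i + n + 1) := Nat.lt_pow_self (by omega)
  obtain ⟨t, ht⟩ := hu.surjective (x - u i)
  refine ⟨b ^ (i + n + 1) * t + i, ?_, ?_⟩
  · rw [hu.apply_pow_block _ _ _ (by omega), ht, sub_add_cancel]
  · rw [factorAt_eq_iff]
    intro p hp
    rw [add_assoc, hu.ruler.apply_block _ _ _ (by omega)]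

/-- First letter and difference word are independent: the prefix containing an occurrence reappears
translated by any letter. -/
theorem mem_factors_succ_iff (hu : IsThueMorseLift b q m κ v u) {n : ℕ} {w : List (ZMod m)} :
    w ∈ factors u (n + 1) ↔ ∃ x, ∃ z ∈ factors v n, w = lift κ x z := by
  constructor
  · intro h
    obtain ⟨i, rfl⟩ := mem_factors_iff.mp h
    exact ⟨u i, _, mem_factors_iff.mpr ⟨i, rfl⟩, hu.factorAt_eq_lift i n⟩
  · rintro ⟨x, z, hz, rfl⟩
    obtain ⟨i, rfl⟩ := mem_factors_iff.mp hz
    obtain ⟨i', rfl, h⟩ := hu.exists_position x i n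
    exact mem_factors_iff.mpr ⟨i', by rw [← h, hu.factorAt_eq_lift]⟩

theorem lift_mem_language (hu : IsThueMorseLift b q m κ v u) (x : ZMod m) {n : ℕ}
    {z : List (ZMod q)} (hz : z ∈ factors v n) : lift κ x z ∈ language u :=
  (hu.mem_factors_succ_iff.mpr ⟨x, z, hz, rfl⟩).1

theorem eq_nil_or_lift (hu : IsThueMorseLift b q m κ v u) {w : List (ZMod m)}
    (hw : w ∈ language u) : w = [] ∨ ∃ n x, ∃ z ∈ factors v n, w = lift κ x z := by
  obtain ⟨i, n, rfl⟩ := hw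
  cases n with
  | zero => exact Or.inl rfl
  | succ n => exact Or.inr ⟨n, hu.mem_factors_succ_iff.mp (mem_factors_iff.mpr ⟨i, rfl⟩)⟩

theorem ncard_lift_image (hu : IsThueMorseLift b q m κ v u) (S : Set (List (ZMod q))) :
    {w | ∃ x, ∃ z ∈ S, w = lift κ x z}.ncard = m * S.ncard := by
  have e : {w | ∃ x, ∃ z ∈ S, w = lift κ x z} =
      (fun p : ZMod m × List (ZMod q) => lift κ p.1 p.2) '' (Set.univ ×ˢ S) := by
    ext w
    simp [eq_comm]
  rw [e, Set.InjOn.ncard_image, Set.ncard_prod, Set.ncard_univ, Nat.card_zmod]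
  rintro ⟨x, z⟩ - ⟨y, z'⟩ - h
  obtain ⟨h1, h2⟩ := lift_injective hu.injective h
  exact Prod.ext h1 h2

theorem complexity_succ (hu : IsThueMorseLift b q m κ v u) (n : ℕ) :
    complexity u (n + 1) = m * complexity v n := by
  rw [complexity, complexity, ← hu.ncard_lift_image]
  congr 1
  ext w
  exact hu.mem_factors_succ_iff

theorem leftExtensions_lift (hu : IsThueMorseLift b q m κ v u) (x : ZMod m)
    (z : List (ZMod q)) :
    leftExtensions u (lift κ x z) = (fun c => x - (1 - κ c)) '' leftExtensions v z := by
  ext a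
  rw [mem_leftExtensions_iff, length_lift]
  simp only [hu.factorAt_eq_lift_iff]
  constructor
  · rintro ⟨i, rfl, rfl, h⟩
    exact ⟨v i, mem_leftExtensions_iff.mpr ⟨i, rfl, h⟩, by
      simp only [hu.apply_succ]; ring⟩
  · rintro ⟨c, hc, rfl⟩
    obtain ⟨i, rfl, h⟩ := mem_leftExtensions_iff.mp hc
    obtain ⟨i', hx, h'⟩ := hu.exists_position (x - (1 - κ (v i))) i (z.length + 1)
    rw [factorAt_succ, factorAt_succ, List.cons.injEq] at h'
    exact ⟨i', hx, by rw [hu.apply_succ, hx, h'.1]; ring, h'.2.trans h⟩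

theorem rightExtensions_lift (hu : IsThueMorseLift b q m κ v u) (x : ZMod m)
    (z : List (ZMod q)) : rightExtensions u (lift κ x z) =
      (fun c => x + increment κ z + (1 - κ c)) '' rightExtensions v z := by
  ext a
  rw [mem_rightExtensions_iff, length_lift]
  simp only [hu.factorAt_eq_lift_iff]
  constructor
  · rintro ⟨i, ⟨rfl, h⟩, rfl⟩
    refine ⟨v (i + z.length), mem_rightExtensions_iff.mpr ⟨i, h, rfl⟩, ?_⟩
    simp only
    rw [← add_assoc i, hu.apply_succ, hu.apply_add, h]
  · rintro ⟨c, hc, rfl⟩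
    obtain ⟨i, h, rfl⟩ := mem_rightExtensions_iff.mp hc
    obtain ⟨i', hx, h'⟩ := hu.exists_position x i (z.length + 1)
    rw [factorAt_succ', factorAt_succ'] at h'
    obtain ⟨h1, h2⟩ := List.append_inj' h' rfl
    rw [h] at h1
    refine ⟨i', ⟨hx, h1⟩, ?_⟩
    rw [← add_assoc i', hu.apply_succ, hu.apply_add, h1, hx]
    simp only [List.cons.injEq, and_true] at h2
    rw [h2]

theorem mem_bispecialFactors_succ_iff (hu : IsThueMorseLift b q m κ v u) {n : ℕ}
    {w : List (ZMod m)} :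
    w ∈ bispecialFactors u (n + 1) ↔ ∃ x, ∃ z ∈ bispecialFactors v n, w = lift κ x z := by
  have key : ∀ x z, ((leftExtensions u (lift κ x z)).Nontrivial ↔
      (leftExtensions v z).Nontrivial) ∧ ((rightExtensions u (lift κ x z)).Nontrivial ↔
      (rightExtensions v z).Nontrivial) := by
    intro x z
    rw [hu.leftExtensions_lift, hu.rightExtensions_lift]
    constructor
    · exact Set.image_nontrivial fun c d h =>
        hu.injective (sub_right_injective (sub_right_injective h))
    · exact Set.image_nontrivial fun c d h =>
        hu.injective (sub_right_injective (add_right_injective _ h))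
  constructor
  · rintro ⟨hw, hl, hr⟩
    obtain ⟨x, z, hz, rfl⟩ := hu.mem_factors_succ_iff.mp hw
    exact ⟨x, z, ⟨hz, (key x z).1.mp hl, (key x z).2.mp hr⟩, rfl⟩
  · rintro ⟨x, z, ⟨hz, hl, hr⟩, rfl⟩
    exact ⟨hu.mem_factors_succ_iff.mpr ⟨x, z, hz, rfl⟩, (key x z).1.mpr hl, (key x z).2.mpr hr⟩

theorem ncard_bispecialFactors_succ (hu : IsThueMorseLift b q m κ v u) (n : ℕ) :
    (bispecialFactors u (n + 1)).ncard = m * (bispecialFactors v n).ncard := by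
  rw [← hu.ncard_lift_image]
  congr 1
  ext w
  exact hu.mem_bispecialFactors_succ_iff

/-! ### Frequencies of the factors of the generalized Thue-Morse word -/

theorem exists_pow_covering (hu : IsThueMorseLift b q m κ v u) :
    ∃ L, ∀ x, ∃ r < b ^ L, u r = x := by
  have := hu.neZero
  have hb := hu.ruler.two_le_base
  choose j hj using hu.surjective
  refine ⟨∑ x, j x, fun x => ⟨j x, ?_, hj x⟩⟩
  exact (Finset.single_le_sum (f := j) (fun _ _ => Nat.zero_le _) (Finset.mem_univ x)).trans_lt
    (Nat.lt_pow_self (by omega))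

theorem indicator_letter_block (hu : IsThueMorseLift b q m κ v u) {L r : ℕ} (hr : r < b ^ L)
    (x : ZMod m) : (fun t => {i | u i = x}.indicator (1 : ℕ → ℝ) (b ^ L * t + r)) =
      {i | u i = x - u r}.indicator 1 := by
  classical
  ext t
  rw [Set.indicator_apply, Set.indicator_apply]
  refine if_congr ?_ rfl rfl
  rw [Set.mem_ofPred_eq, Set.mem_ofPred_eq, hu.apply_pow_block _ _ _ hr, eq_sub_iff_add_eq]

/-- The numbers of occurrences of two letters in a window differ little. -/
theorem letter_difference_contraction (hu : IsThueMorseLift b q m κ v u) {L : ℕ}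
    (hL : ∀ x, ∃ r < b ^ L, u r = x) (k : ℕ) : ∃ K : ℝ, 0 ≤ K ∧ ∀ x y i n,
      |windowSum ({j | u j = x}.indicator 1) i n - windowSum ({j | u j = y}.indicator 1) i n| ≤
        (1 - 1 / (b : ℝ) ^ L) ^ k * n + K := by
  have hb := hu.ruler.two_le_base
  induction k with
  | zero =>
    refine ⟨0, le_rfl, fun x y i n => ?_⟩
    rw [pow_zero, one_mul, add_zero, abs_le]
    have h1 := windowSum_nonneg (indicator_one_nonneg {j | u j = x}) i n
    have h2 := windowSum_nonneg (indicator_one_nonneg {j | u j = y}) i n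
    have h3 := windowSum_le (indicator_one_le_one {j | u j = x}) i n
    have h4 := windowSum_le (indicator_one_le_one {j | u j = y}) i n
    constructor <;> linarith
  | succ k ih =>
    obtain ⟨K, hK0, hK⟩ := ih
    have hB : 0 < b ^ L := Nat.pow_pos (by omega)
    have hB1 : (1 : ℝ) ≤ (b : ℝ) ^ L := by exact_mod_cast hB
    set a : ℝ := (1 - 1 / (b : ℝ) ^ L) ^ k with ha
    have ha0 : 0 ≤ a := pow_nonneg (sub_nonneg.mpr ((div_le_one (by linarith)).mpr hB1)) k
    refine ⟨((b : ℝ) ^ L - 1) * (a + K) + 2 * (b : ℝ) ^ L,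
      add_nonneg (mul_nonneg (by linarith) (by linarith)) (by linarith), fun x y i n => ?_⟩
    have key : ∀ x, |windowSum ({j | u j = x}.indicator 1) i n - ∑ r ∈ Finset.range (b ^ L),
        windowSum ({j | u j = x - u r}.indicator 1) (i / b ^ L)
          ((i + n) / b ^ L - i / b ^ L)| ≤ (b : ℝ) ^ L := by
      intro x
      have := abs_windowSum_sub_blocks_le (indicator_one_nonneg {j | u j = x})
        (indicator_one_le_one {j | u j = x}) hB i n
      rw [Nat.cast_pow] at this
      convert this using 4 with r hr
      rw [hu.indicator_letter_block (Finset.mem_range.mp hr)]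
    have hlen := abs_block_length_sub_le hB i n
    rw [Nat.cast_pow] at hlen
    have hx := key x
    have hy := key y
    set n' := (i + n) / b ^ L - i / b ^ L
    set W : ZMod m → ℝ := fun x => windowSum ({j | u j = x}.indicator 1) (i / b ^ L) n' with hW
    have hx' : |windowSum ({j | u j = x}.indicator 1) i n -
      ∑ r ∈ Finset.range (b ^ L), W (x - u r)| ≤ (b : ℝ) ^ L := hx
    have hy' : |windowSum ({j | u j = y}.indicator 1) i n -
      ∑ r ∈ Finset.range (b ^ L), W (y - u r)| ≤ (b : ℝ) ^ L := hy
    -- Residue $0$ for `x` and residue `s` for `y` both contribute `W x`. Swapping $0$ and `s` in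
    -- the second sum cancels this term, leaving $b^L-1$ of $b^L$ terms: the contraction ratio.
    obtain ⟨s, hs, hsu⟩ := hL (y - x)
    have hsum : |∑ r ∈ Finset.range (b ^ L), W (x - u r) -
        ∑ r ∈ Finset.range (b ^ L), W (y - u r)| ≤ ((b : ℝ) ^ L - 1) * (a * n' + K) := by
      rw [← Fin.sum_univ_eq_sum_range (fun r => W (x - u r)),
        ← Fin.sum_univ_eq_sum_range (fun r => W (y - u r)),
        ← Equiv.sum_comp (Equiv.swap (⟨0, hB⟩ : Fin (b ^ L)) ⟨s, hs⟩)
          (fun r : Fin (b ^ L) => W (y - u r)), ← Finset.sum_sub_distrib,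
        ← Finset.add_sum_erase _ _ (Finset.mem_univ (⟨0, hB⟩ : Fin (b ^ L)))]
      simp only [Equiv.swap_apply_left, hu.apply_zero, hsu, sub_sub_cancel, sub_zero, sub_self,
        zero_add]
      refine (Finset.abs_sum_le_sum_abs _ _).trans
        ((Finset.sum_le_card_nsmul _ _ (a * n' + K) fun r _ => hK _ _ _ _).trans ?_)
      rw [Finset.card_erase_of_mem (Finset.mem_univ _), Finset.card_univ, Fintype.card_fin,
        nsmul_eq_mul, Nat.cast_sub hB, Nat.cast_pow, Nat.cast_one]
    have hn' : a * n' ≤ a * (n / (b : ℝ) ^ L + 1) :=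
      mul_le_mul_of_nonneg_left (by rw [abs_le] at hlen; linarith [hlen.2]) ha0
    have hmul : ((b : ℝ) ^ L - 1) * (a * n' + K) ≤
        ((b : ℝ) ^ L - 1) * (a * (n / (b : ℝ) ^ L + 1) + K) :=
      mul_le_mul_of_nonneg_left (by linarith) (by linarith)
    have heq : ((b : ℝ) ^ L - 1) * (a * (n / (b : ℝ) ^ L + 1) + K) =
        (1 - 1 / (b : ℝ) ^ L) ^ (k + 1) * n + ((b : ℝ) ^ L - 1) * (a + K) := by
      rw [pow_succ, ← ha]
      field_simp
      ring
    rw [abs_le] at *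
    constructor <;> linarith

theorem hasMean_letter (hu : IsThueMorseLift b q m κ v u) (x : ZMod m) :
    HasMean ({j | u j = x}.indicator 1) (1 / m) := by
  have := hu.neZero
  have hb := hu.ruler.two_le_base
  have hm : (0 : ℝ) < m := by exact_mod_cast Nat.pos_of_ne_zero this.out
  obtain ⟨L, hL⟩ := hu.exists_pow_covering
  intro ε hε
  have hB1 : (1 : ℝ) ≤ (b : ℝ) ^ L := one_le_pow₀ (by exact_mod_cast (by omega : 1 ≤ b))
  obtain ⟨k, hk⟩ := exists_pow_lt_of_lt_one hε (show 1 - 1 / (b : ℝ) ^ L < 1 by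
    have : 0 < 1 / (b : ℝ) ^ L := by positivity
    linarith)
  obtain ⟨K, -, hK⟩ := hu.letter_difference_contraction hL k
  refine ⟨K, fun i n => ?_⟩
  have htot : ∑ y : ZMod m, windowSum ({j | u j = y}.indicator 1) i n = n := by
    rw [← windowSum_sum]
    have e : ∑ y : ZMod m, {j | u j = y}.indicator (1 : ℕ → ℝ) = 1 := by
      classical
      ext j
      simp [Finset.sum_apply, Set.indicator_apply]
    rw [e]
    simp [windowSum]
  have hdiff : m * (windowSum ({j | u j = x}.indicator 1) i n - 1 / m * n) =
      ∑ y : ZMod m, (windowSum ({j | u j = x}.indicator 1) i n -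
        windowSum ({j | u j = y}.indicator 1) i n) := by
    rw [Finset.sum_sub_distrib, htot, Finset.sum_const, Finset.card_univ, ZMod.card, nsmul_eq_mul]
    field_simp
  have hle : |m * (windowSum ({j | u j = x}.indicator 1) i n - 1 / m * n)| ≤
      m * (ε * n + K) := by
    rw [hdiff]
    refine (Finset.abs_sum_le_sum_abs _ _).trans
      ((Finset.sum_le_card_nsmul _ _ (ε * n + K) fun y _ => (hK x y i n).trans ?_).trans ?_)
    · gcongr
    · rw [Finset.card_univ, ZMod.card, nsmul_eq_mul]
  rw [abs_mul, abs_of_pos hm] at hle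
  exact le_of_mul_le_mul_left hle hm

/-- In blocks of length $b^L$, an occurrence inside a block is governed by the letter indexing that
block, and letters have mean $1/m$. Hence the mean does not depend on `x`. -/
theorem exists_hasMean_lift (hu : IsThueMorseLift b q m κ v u) (z : List (ZMod q)) :
    ∃ a, ∀ x, HasMean ((positions u (lift κ x z)).indicator 1) a := by
  classical
  have := hu.neZero
  have hb := hu.ruler.two_le_base
  refine exists_hasMean_of_nearMean fun ε hε => ?_
  obtain ⟨L, hL⟩ := pow_unbounded_of_one_lt ((z.length : ℝ) / (ε / 2))
    (show (1 : ℝ) < b by exact_mod_cast (by omega : 1 < b))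
  have hB : 0 < b ^ L := Nat.pow_pos (by omega)
  have hB' : (0 : ℝ) < (b : ℝ) ^ L := by exact_mod_cast hB
  -- At most $|z|$ residues near the block end are undecided; they get mean $0$ with error $1$, and
  -- the choice of `L` makes their total share less than $\varepsilon/2$.
  refine ⟨(∑ r ∈ Finset.range (b ^ L), if r + z.length < b ^ L ∧ factorAt v r z.length = z then
    1 / (m : ℝ) else 0) / (b ^ L : ℕ), fun x => ?_⟩
  have h := NearMean.of_blocks (indicator_one_nonneg (positions u (lift κ x z)))
    (indicator_one_le_one (positions u (lift κ x z))) hB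
    (fun r => if r + z.length < b ^ L ∧ factorAt v r z.length = z then 1 / (m : ℝ) else 0)
    (fun r => if r + z.length < b ^ L then ε / 2 else 1) ?_
  · refine h.mono ?_
    rw [Nat.cast_pow, div_le_iff₀ hB']
    have hs : ∀ r ∈ Finset.range (b ^ L), (if r + z.length < b ^ L then ε / 2 else 1) ≤
        ε / 2 + if r ∈ Finset.Ico (b ^ L - z.length) (b ^ L) then 1 else 0 := by
      intro r hr
      have hr' := Finset.mem_range.mp hr
      simp only [Finset.mem_Ico]
      split_ifs <;> first | (exfalso; omega) | linarith
    refine (Finset.sum_le_sum hs).trans ?_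
    rw [Finset.sum_add_distrib, Finset.sum_ite_mem, Finset.sum_const, Finset.sum_const,
      Finset.card_range, nsmul_eq_mul, nsmul_eq_mul, mul_one, Nat.cast_pow]
    have hc : ((Finset.range (b ^ L) ∩ Finset.Ico (b ^ L - z.length) (b ^ L)).card : ℝ) ≤
        z.length := by
      have : (Finset.range (b ^ L) ∩ Finset.Ico (b ^ L - z.length) (b ^ L)).card ≤ z.length := by
        refine (Finset.card_le_card Finset.inter_subset_right).trans ?_
        rw [Nat.card_Ico]
        omega
      exact_mod_cast this
    rw [div_lt_iff₀ (by positivity)] at hL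
    linarith
  · intro r hr
    by_cases hrz : r + z.length < b ^ L
    · have hpos : ∀ t, b ^ L * t + r ∈ positions u (lift κ x z) ↔
          u t = x - u r ∧ factorAt v r z.length = z := by
        intro t
        have hf : factorAt v (b ^ L * t + r) z.length = factorAt v r z.length := by
          rw [factorAt_eq_iff]
          intro p hp
          rw [add_assoc, hu.ruler.apply_block _ _ _ (by omega)]
        rw [positions, Set.mem_ofPred_eq, length_lift, hu.factorAt_eq_lift_iff,
          hu.apply_pow_block _ _ _ hr, hf, eq_sub_iff_add_eq]
      by_cases hz : factorAt v r z.length = z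
      · rw [if_pos ⟨hrz, hz⟩, if_pos hrz]
        have e : (fun t => (positions u (lift κ x z)).indicator (1 : ℕ → ℝ) (b ^ L * t + r)) =
            {t | u t = x - u r}.indicator 1 := by
          ext t
          rw [Set.indicator_apply, Set.indicator_apply]
          refine if_congr ?_ rfl rfl
          rw [hpos, Set.mem_ofPred_eq, and_iff_left hz]
        rw [e]
        exact hu.hasMean_letter _ _ (half_pos hε)
      · rw [if_neg fun h => hz h.2, if_pos hrz]
        have e : (fun t => (positions u (lift κ x z)).indicator (1 : ℕ → ℝ) (b ^ L * t + r)) =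
            0 := by
          ext t
          rw [Set.indicator_of_notMem fun h => hz ((hpos t).mp h).2, Pi.zero_apply]
        rw [e]
        exact hasMean_zero _ (half_pos hε)
    · rw [if_neg fun h => hrz h.1, if_neg hrz]
      refine ⟨0, fun i n => ?_⟩
      have h1 := windowSum_nonneg (f := fun t => (positions u (lift κ x z)).indicator 1
        (b ^ L * t + r)) (fun k => indicator_one_nonneg _ _) i n
      have h2 := windowSum_le (f := fun t => (positions u (lift κ x z)).indicator 1
        (b ^ L * t + r)) (fun k => indicator_one_le_one _ _) i n
      rw [abs_le]
      constructor <;> linarith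

/-- Every occurrence of `z` in `v` lies below exactly one letter of `u`, so the density of `z` is
the sum of $m$ equal means. -/
theorem exists_density (hu : IsThueMorseLift b q m κ v u) : ∃ ρ, IsDensity v ρ ∧
    ∀ x z, HasFrequency u (lift κ x z) (ρ z / m) := by
  classical
  have := hu.neZero
  have hm : (m : ℝ) ≠ 0 := by exact_mod_cast this.out
  choose a ha using hu.exists_hasMean_lift
  refine ⟨fun z => m * a z, fun z => ?_, fun x z => ?_⟩
  · have h := HasMean.sum Finset.univ fun x (_ : x ∈ Finset.univ) => ha z x
    rw [Finset.sum_const, Finset.card_univ, ZMod.card, nsmul_eq_mul] at h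
    convert h using 1
    ext i
    have hp : ∀ x, i ∈ positions u (lift κ x z) ↔ u i = x ∧ i ∈ positions v z := fun x => by
      rw [positions, Set.mem_ofPred_eq, length_lift, hu.factorAt_eq_lift_iff]
      rfl
    simp only [Finset.sum_apply, Set.indicator_apply, hp, Pi.one_apply]
    by_cases hi : i ∈ positions v z <;> simp [hi]
  · rw [mul_div_cancel_left₀ _ hm]
    convert (ha z x).hasFrequency

end IsThueMorseLift

/-! ### Symmetries of a language -/

section Morphisms

variable {A : Type*}

theorem isMorphism_symm {g : Equiv.Perm (List A)} (hg : IsMorphism g) : IsMorphism g.symm := by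
  intro v w
  rw [Equiv.symm_apply_eq, hg, Equiv.apply_symm_apply, Equiv.apply_symm_apply]

theorem IsMorphism.map_nil {g : List A → List A} (hg : IsMorphism g) : g [] = [] := by
  have h := congrArg List.length (hg [] [])
  rw [List.append_nil, List.length_append] at h
  exact List.length_eq_zero_iff.mp (by omega)

/-- Injectivity forbids erasing a letter. Applied also to the inverse, this forces letters to go to
letters. -/
theorem length_le_length_of_isMorphism {g : Equiv.Perm (List A)} (hg : IsMorphism g)
    (w : List A) : w.length ≤ (g w).length := by
  induction w with
  | nil => simp
  | cons a w ih =>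
    have h : g (a :: w) = g [a] ++ g w := hg [a] w
    have h1 : 0 < (g [a]).length := by
      rw [List.length_pos_iff]
      intro h
      rw [← hg.map_nil] at h
      exact absurd (g.injective h) (List.cons_ne_nil _ _)
    rw [h, List.length_append, List.length_cons]
    omega

/-- Invertible morphisms of a free monoid act by permutations of the letters. -/
theorem exists_eq_map_of_isMorphism {g : Equiv.Perm (List A)} (hg : IsMorphism g) :
    ∃ f : A → A, Function.Injective f ∧ ∀ w, g w = w.map f := by
  have hl : ∀ a, ∃ c, g [a] = [c] := by
    intro a
    have h1 := length_le_length_of_isMorphism hg [a]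
    have h2 := length_le_length_of_isMorphism (isMorphism_symm hg) (g [a])
    rw [Equiv.symm_apply_apply] at h2
    exact List.length_eq_one_iff.mp (le_antisymm h2 h1)
  choose f hf using hl
  refine ⟨f, fun a c h => ?_, fun w => ?_⟩
  · have : g [a] = g [c] := by rw [hf, hf, h]
    simpa using g.injective this
  · induction w with
    | nil => exact hg.map_nil
    | cons a w ih =>
      have h : g (a :: w) = g [a] ++ g w := hg [a] w
      rw [h, hf, ih, List.map_cons, List.singleton_append]

theorem occurrences_map [DecidableEq A] {f : A → A} (hf : Function.Injective f) (w z : List A) :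
    occurrences (w.map f) (z.map f) = occurrences w z := by
  simp only [occurrences, List.length_map, ← List.map_drop, List.prefix_map_iff_of_injective hf]

/-- Letter permutations preserving the language preserve frequencies. -/
theorem HasFrequency.eq_of_map [DecidableEq A] {u : ℕ → A} {f : A → A}
    (hf : Function.Injective f) (hinv : ∀ w ∈ language u, w.map f ∈ language u) {w : List A}
    {r s : ℝ} (hr : HasFrequency u w r) (hs : HasFrequency u (w.map f) s) : r = s := by
  have ht : Tendsto (fun n => (factorAt u 0 n).map f) atTop
      (comap List.length atTop ⊓ 𝓟 (language u)) := by
    refine tendsto_inf.mpr ⟨tendsto_comap_iff.mpr ?_, tendsto_principal.mpr ?_⟩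
    · have : List.length ∘ (fun n => (factorAt u 0 n).map f) = id :=
        funext fun n => by simp [length_factorAt]
      rw [this]
      exact tendsto_id
    · exact Eventually.of_forall fun n => hinv _ (factorAt_mem_language u 0 n)
  refine tendsto_nhds_unique (hr.comp (tendsto_factorAt u 0)) ((hs.comp ht).congr fun n => ?_)
  simp only [Function.comp_apply, occurrences_map hf, List.length_map]

end Morphisms

theorem isMorphism_translation {m : ℕ} (x : ZMod m) : IsMorphism (translation x) :=
  fun _ _ => List.map_append

theorem isAntimorphism_reflection {m : ℕ} (x : ZMod m) : IsAntimorphism (reflection x) := by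
  intro v w
  change (List.map _ (v ++ w)).reverse = (List.map _ w).reverse ++ (List.map _ v).reverse
  rw [List.map_append, List.reverse_append]

theorem translation_singleton {m : ℕ} (x k : ZMod m) : translation x [k] = [x + k] := rfl

theorem reflection_singleton {m : ℕ} (x k : ZMod m) : reflection x [k] = [x - k] := rfl

theorem translation_injective (m : ℕ) :
    Function.Injective (translation : ZMod m → Equiv.Perm (List (ZMod m))) := by
  intro x y h
  have := congrArg (fun g : Equiv.Perm (List (ZMod m)) => g [0]) h
  simpa [translation_singleton] using this

theorem reflection_injective (m : ℕ) :
    Function.Injective (reflection : ZMod m → Equiv.Perm (List (ZMod m))) := by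
  intro x y h
  have := congrArg (fun g : Equiv.Perm (List (ZMod m)) => g [0]) h
  simpa [reflection_singleton] using this

theorem finite_dihedral (m : ℕ) [NeZero m] : (dihedral m : Set (Equiv.Perm (List (ZMod m)))).Finite :=
  (Set.finite_range _).union (Set.finite_range _)

theorem card_dihedral {m : ℕ} (hm : 2 ≤ m) : Nat.card (dihedral m) = 2 * m := by
  have : NeZero m := ⟨by omega⟩
  have : Fact (1 < m) := ⟨hm⟩
  have e : Nat.card (dihedral m) = (Set.range (translation (m := m)) ∪ Set.range reflection).ncard :=
    Nat.card_coe_set_eq _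
  rw [e, Set.ncard_union_eq]
  · rw [← Set.image_univ, ← Set.image_univ, Set.ncard_image_of_injective _ (translation_injective m),
      Set.ncard_image_of_injective _ (reflection_injective m), Set.ncard_univ, Nat.card_zmod, two_mul]
  · rw [Set.disjoint_left]
    rintro _ ⟨x, rfl⟩ ⟨y, h⟩
    -- For $m=2$ the two kinds agree on letters for equal parameters, so a two-letter word is needed
    -- to see the reversed order: it gives $y=x+1$, against $y=x$ from the letter $0$.
    have h2 : reflection y [0, 1] = translation x [0, 1] := by rw [h]
    have h3 : [y - 1, y - 0] = [x + 0, x + 1] := h2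
    have h1 : y - 1 = x + 0 := (List.cons.inj h3).1
    have h4 : [y - 0] = [x + 1] := (List.cons.inj h3).2
    have h0 : reflection y [0] = translation x [0] := by rw [h]
    have h5 : [y - 0] = [x + 0] := h0
    rw [h5] at h4
    exact one_ne_zero (add_left_cancel (List.cons.inj h4).1).symm

/-! ### Determination of the admissible groups. -/

namespace IsThueMorseLift

variable {b q m : ℕ} {κ : ZMod q →+ ZMod m} {v : ℕ → ZMod q} {u : ℕ → ZMod m}

theorem translation_mem_language (hu : IsThueMorseLift b q m κ v u) (x : ZMod m)
    {w : List (ZMod m)} (hw : w ∈ language u) : translation x w ∈ language u := by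
  rcases hu.eq_nil_or_lift hw with rfl | ⟨n, y, z, hz, rfl⟩
  · exact hw
  · have e : translation x (lift κ y z) = lift κ (x + y) z := map_add_lift x y z
    rw [e]
    exact hu.lift_mem_language _ hz

theorem reflection_mem_language (hu : IsThueMorseLift b q m κ v u) (x : ZMod m)
    {w : List (ZMod m)} (hw : w ∈ language u) : reflection x w ∈ language u := by
  rcases hu.eq_nil_or_lift hw with rfl | ⟨n, y, z, hz, rfl⟩
  · exact hw
  · rw [reflection_lift]
    exact hu.lift_mem_language _ (hu.ruler.reverse_mem_factors hz)

theorem isSymmetryGroup_dihedral (hu : IsThueMorseLift b q m κ v u) :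
    IsSymmetryGroup u (dihedral m) where
  finite := by
    have := hu.neZero
    exact finite_dihedral m
  morphism_or_antimorphism := by
    rintro _ (⟨x, rfl⟩ | ⟨x, rfl⟩)
    · exact Or.inl (isMorphism_translation x)
    · exact Or.inr (isAntimorphism_reflection x)
  exists_antimorphism := ⟨reflection 0, Or.inr ⟨0, rfl⟩, isAntimorphism_reflection 0⟩
  invariant := by
    rintro _ (⟨x, rfl⟩ | ⟨x, rfl⟩) w hw
    · exact hu.translation_mem_language x hw
    · exact hu.reflection_mem_language x hw

/-- The pair $a(a+1)$ lifts the letter $0$ of the ruler word. Its image has the same frequency,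
hence also lifts $0$, so the letter permutation commutes with adding $1$. -/
theorem eq_translation_of_isMorphism (hu : IsThueMorseLift b q m κ v u)
    {g : Equiv.Perm (List (ZMod m))} (hg : IsMorphism g)
    (hinv : ∀ w ∈ language u, g w ∈ language u) : ∃ x, g = translation x := by
  have := hu.neZero
  have hm : (m : ℝ) ≠ 0 := by exact_mod_cast this.out
  obtain ⟨f, hf, hgf⟩ := exists_eq_map_of_isMorphism hg
  obtain ⟨ρ, hρ, hfreq⟩ := hu.exists_density
  have hinv' : ∀ w ∈ language u, w.map f ∈ language u := fun w hw => hgf w ▸ hinv w hw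
  have hstep : ∀ a, f (a + 1) = f a + 1 := by
    intro a
    have e : lift κ a [0] = [a, a + 1] := by simp [lift]
    have hmem := hinv' _ (hu.lift_mem_language a (hu.ruler.singleton_mem_factors 0))
    obtain ⟨y, z, hz, hyz⟩ := hu.mem_factors_succ_iff.mp
      (show (lift κ a [0]).map f ∈ factors u (1 + 1) from ⟨hmem, by simp [length_lift]⟩)
    obtain ⟨c, rfl⟩ := hu.ruler.mem_factors_one_iff.mp hz
    have hρc := (hfreq a [0]).eq_of_map hf hinv' (hyz ▸ hfreq y [c])
    obtain rfl := hu.ruler.eq_zero_of_density_eq hρ ((div_left_inj' hm).mp hρc.symm)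
    rw [e] at hyz
    have h : [f a, f (a + 1)] = [y, y + (1 - κ 0)] := hyz
    rw [map_zero, sub_zero] at h
    simp only [List.cons.injEq, and_true] at h
    rw [h.1, h.2]
  have hnat : ∀ k : ℕ, f k = f 0 + k := by
    intro k
    induction k with
    | zero => simp
    | succ k ih => rw [Nat.cast_succ, hstep, ih, add_assoc]
  refine ⟨f 0, Equiv.ext fun w => (hgf w).trans (List.map_congr_left fun k _ => ?_)⟩
  have := hnat k.val
  rwa [ZMod.natCast_zmod_val] at this

/-- Every admissible group is contained in the dihedral group. -/
theorem le_dihedral (hu : IsThueMorseLift b q m κ v u) {G : Subgroup (Equiv.Perm (List (ZMod m)))}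
    (hG : IsSymmetryGroup u G) : G ≤ dihedral m := by
  intro g hg
  rcases hG.morphism_or_antimorphism g hg with h | h
  · obtain ⟨x, rfl⟩ := hu.eq_translation_of_isMorphism h (hG.invariant g hg)
    exact Or.inl ⟨x, rfl⟩
  · have hmor : IsMorphism (g * reflection 0 : Equiv.Perm (List (ZMod m))) := by
      intro v w
      rw [Equiv.Perm.mul_apply, isAntimorphism_reflection, h, Equiv.Perm.mul_apply,
        Equiv.Perm.mul_apply]
    obtain ⟨x, hx⟩ := hu.eq_translation_of_isMorphism hmor fun w hw =>
      hG.invariant g hg _ (hu.reflection_mem_language 0 hw)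
    rw [eq_mul_inv_of_mul_eq hx]
    exact (dihedral m).mul_mem (Or.inl ⟨x, rfl⟩) ((dihedral m).inv_mem (Or.inr ⟨0, rfl⟩))

theorem card_le (hu : IsThueMorseLift b q m κ v u) {G : Subgroup (Equiv.Perm (List (ZMod m)))}
    (hG : IsSymmetryGroup u G) : 0 < Nat.card G ∧ Nat.card G ≤ 2 * m := by
  have := hu.neZero
  have := hG.finite
  have := hu.isSymmetryGroup_dihedral.finite
  refine ⟨Nat.card_pos, ?_⟩
  rw [← card_dihedral hu.two_le]
  exact Nat.card_le_card_of_injective _ (Subgroup.inclusion_injective (hu.le_dihedral hG))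

/-! ### The bound on the number of frequencies -/

theorem ncard_palindromicBispecialFactors_le [Finite (ZMod m)] (u : ℕ → ZMod m)
    (G : Subgroup (Equiv.Perm (List (ZMod m)))) (n : ℕ) :
    (palindromicBispecialFactors u G n).ncard ≤ (bispecialFactors u n).ncard :=
  Set.ncard_le_ncard (fun _ h => h.1) ((finite_factors u n).subset fun _ h => h.1)

theorem complexity_succ_ge (hv : IsRulerWord b q v) (n : ℕ) :
    complexity v n + 1 ≤ complexity v (n + 1) := by
  have hq := hv.two_le_modulus
  have hb := hv.two_le_base
  induction n using Nat.strong_induction_on with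
  | _ n ih =>
    rcases lt_or_ge n b with h1 | h1
    · have := hv.complexity_succ_of_lt h1
      omega
    rcases le_or_gt n (2 * b - 2) with h2 | h2
    · have := hv.complexity_succ_of_le_of_le h1 h2
      omega
    · have := hv.complexity_succ_of_ge (n := n) (by omega)
      have := ih (n / b) (Nat.div_lt_self (by omega) (by omega))
      omega

theorem ncard_bispecialFactors_le_one (hv : IsRulerWord b q v) (n : ℕ) :
    (bispecialFactors v n).ncard ≤ 1 := by
  have hb := hv.two_le_base
  induction n using Nat.strong_induction_on with
  | _ n ih =>
    rcases le_or_gt n (2 * b - 2) with h | h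
    · exact hv.ncard_bispecialFactors_le_one h
    by_cases hdvd : b ∣ n + 1
    · obtain ⟨c, hc⟩ := hdvd
      obtain ⟨k, rfl⟩ : ∃ k, c = k + 1 :=
        Nat.exists_eq_add_one_of_ne_zero (by rintro rfl; omega)
      have hn : n = b * k + (b - 1) := by rw [Nat.mul_add] at hc; omega
      have hk : 1 ≤ k := Nat.pos_of_ne_zero (by rintro rfl; omega)
      have hbk := Nat.le_mul_of_pos_left k (show 0 < b by omega)
      have := hv.ncard_bispecialFactors_block_le hk
      rw [← hn] at this
      exact this.trans (ih k (by omega))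
    · exact (hv.ncard_bispecialFactors_eq_zero (by omega) hdvd).trans_le zero_le_one

/-- From $Y\le X=mX_v$ one gets $B_G\ge1+\frac{2m}{\#G}(2\Delta-X_v)$. The bracket is nonnegative
because $\Delta\ge1$ and $X_v\le1$, so $\#G=2m$ is the worst case. -/
theorem le_frequencyBound (hu : IsThueMorseLift b q m κ v u)
    {G : Subgroup (Equiv.Perm (List (ZMod m)))} (hG : IsSymmetryGroup u G) (n : ℕ) :
    1 + 2 * ((complexity v (n + 1) : ℝ) - complexity v n) - (bispecialFactors v n).ncard ≤
      frequencyBound u G (n + 1) := by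
  have := hu.neZero
  obtain ⟨hG0, hGm⟩ := hu.card_le hG
  have hY := ncard_palindromicBispecialFactors_le u G (n + 1)
  rw [hu.ncard_bispecialFactors_succ] at hY
  have hC := complexity_succ_ge hu.ruler n
  have hX := ncard_bispecialFactors_le_one hu.ruler n
  rw [frequencyBound, hu.complexity_succ, hu.complexity_succ, hu.ncard_bispecialFactors_succ]
  have hY' : ((palindromicBispecialFactors u G (n + 1)).ncard : ℝ) ≤
      m * (bispecialFactors v n).ncard := by exact_mod_cast hY
  have hC' : (complexity v n : ℝ) + 1 ≤ complexity v (n + 1) := by exact_mod_cast hC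
  have hX' : ((bispecialFactors v n).ncard : ℝ) ≤ 1 := by exact_mod_cast hX
  have hG0' : (0 : ℝ) < Nat.card G := by exact_mod_cast hG0
  have hGm' : (Nat.card G : ℝ) ≤ 2 * m := by exact_mod_cast hGm
  push_cast
  rw [one_div, inv_mul_eq_div, le_div_iff₀ hG0']
  nlinarith [mul_nonneg (sub_nonneg.mpr hGm')
    (show 0 ≤ 2 * ((complexity v (n + 1) : ℝ) - complexity v n) -
      (bispecialFactors v n).ncard by linarith)]

theorem frequencyBound_dihedral (hu : IsThueMorseLift b q m κ v u) {n : ℕ}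
    (hpal : ∀ w ∈ bispecialFactors v n, w.reverse = w) :
    frequencyBound u (dihedral m) (n + 1) =
      1 + 2 * ((complexity v (n + 1) : ℝ) - complexity v n) - (bispecialFactors v n).ncard := by
  have := hu.neZero
  have hm : (m : ℝ) ≠ 0 := by exact_mod_cast this.out
  have e : palindromicBispecialFactors u (dihedral m) (n + 1) = bispecialFactors u (n + 1) := by
    refine Set.Subset.antisymm (fun _ h => h.1) fun w hw => ⟨hw, ?_⟩
    obtain ⟨x, z, hz, rfl⟩ := hu.mem_bispecialFactors_succ_iff.mp hw
    -- The parameter is the sum of the first and last letters, which the reflection must exchange.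
    refine ⟨reflection (x + (x + increment κ z)), Or.inr ⟨_, rfl⟩,
      isAntimorphism_reflection _, ?_⟩
    rw [reflection_lift, hpal z hz, add_sub_cancel_right]
  rw [frequencyBound, e, card_dihedral hu.two_le, hu.complexity_succ, hu.complexity_succ,
    hu.ncard_bispecialFactors_succ]
  push_cast
  field_simp
  ring

/-! ### Comparison of the number of frequencies with the bound. -/

theorem frequencies_eq_image (hu : IsThueMorseLift b q m κ v u) {ρ : List (ZMod q) → ℝ}
    (hfreq : ∀ x z, HasFrequency u (lift κ x z) (ρ z / m)) (n : ℕ) :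
    frequencies u (n + 1) = (· / (m : ℝ)) '' (ρ '' factors v n) := by
  ext r
  constructor
  · rintro ⟨w, hw, hr⟩
    obtain ⟨x, z, hz, rfl⟩ := hu.mem_factors_succ_iff.mp hw
    exact ⟨_, ⟨z, hz, rfl⟩, (hfreq x z).unique hr⟩
  · rintro ⟨_, ⟨z, hz, rfl⟩, rfl⟩
    exact ⟨lift κ 0 z, hu.mem_factors_succ_iff.mpr ⟨0, z, hz, rfl⟩, hfreq 0 z⟩

theorem ncard_frequencies (hu : IsThueMorseLift b q m κ v u) {ρ : List (ZMod q) → ℝ}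
    (hfreq : ∀ x z, HasFrequency u (lift κ x z) (ρ z / m)) (n : ℕ) :
    (frequencies u (n + 1)).ncard = (ρ '' factors v n).ncard := by
  have hm : (m : ℝ) ≠ 0 := by exact_mod_cast hu.neZero.out
  rw [hu.frequencies_eq_image hfreq]
  exact Set.ncard_image_of_injective _ fun x y h => (div_left_inj' hm).mp h

theorem exists_hasFrequency (hu : IsThueMorseLift b q m κ v u) {w : List (ZMod m)}
    (hw : w ∈ language u) : ∃ r, HasFrequency u w r := by
  obtain ⟨ρ, -, hfreq⟩ := hu.exists_density
  rcases hu.eq_nil_or_lift hw with rfl | ⟨n, x, z, -, rfl⟩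
  · refine ⟨1, HasMean.hasFrequency ?_⟩
    have e : positions u [] = Set.univ := Set.eq_univ_of_forall fun i => rfl
    rw [e, Set.indicator_univ]
    exact hasMean_one
  · exact ⟨_, hfreq x z⟩

theorem ncard_frequencies_lt (hu : IsThueMorseLift b q m κ v u) (hq : 2 < q)
    {G : Subgroup (Equiv.Perm (List (ZMod m)))} (hG : IsSymmetryGroup u G) (n : ℕ) :
    ((frequencies u (n + 1)).ncard : ℝ) < frequencyBound u G n := by
  have := hu.neZero
  have hm := hu.two_le
  obtain ⟨ρ, hρ, hfreq⟩ := hu.exists_density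
  cases n with
  | zero =>
    -- Length $0$ has no counterpart in the ruler word. Here the complexity increment is $m-1$ and
    -- $X,Y\le1$, so the bound is at least $1+(4m-6)/\#G>1$, while all letters share one frequency.
    obtain ⟨hG0, hGm⟩ := hu.card_le hG
    have h1 : (frequencies u (0 + 1)).ncard = 1 := by
      have e : factors v 0 = {[]} := Set.ext fun z => IsRulerWord.mem_factors_zero_iff
      rw [hu.ncard_frequencies hfreq, e, Set.image_singleton, Set.ncard_singleton]
    have hY := ncard_palindromicBispecialFactors_le u G 0
    have hX : (bispecialFactors u 0).ncard ≤ 1 := by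
      have hsub : bispecialFactors u 0 ⊆ {[]} := fun w hw => List.length_eq_zero_iff.mp hw.1.2
      simpa using Set.ncard_le_ncard hsub
    have hX' : ((bispecialFactors u 0).ncard : ℝ) ≤ 1 := by exact_mod_cast hX
    have hY' : ((palindromicBispecialFactors u G 0).ncard : ℝ) ≤ 1 := by
      exact_mod_cast hY.trans hX
    have hG0' : (0 : ℝ) < Nat.card G := by exact_mod_cast hG0
    have hm' : (2 : ℝ) ≤ m := by exact_mod_cast hm
    rw [h1, frequencyBound, hu.complexity_succ, complexity_zero, complexity_zero, one_div,
      inv_mul_eq_div, lt_div_iff₀ hG0']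
    push_cast
    linarith
  | succ n =>
    refine lt_of_lt_of_le ?_ (hu.le_frequencyBound hG n)
    have h := hu.ruler.ncard_density_add_lt hρ hq n
    rw [hu.ncard_frequencies hfreq]
    have h' : ((ρ '' factors v (n + 1)).ncard : ℝ) + (bispecialFactors v n).ncard +
        2 * complexity v n < 1 + 2 * complexity v (n + 1) := by exact_mod_cast h
    linarith

/-- Length $N=(2b-1)b^\ell$ in `u` is length $N-1$ in `v`, where $\Delta=2$ and $X_v=1$: hence the
value $1+2\cdot2-1=4$. -/
theorem frequencies_and_bound_of_modulus_two {κ : ZMod 2 →+ ZMod m} {v : ℕ → ZMod 2}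
    (hu : IsThueMorseLift b 2 m κ v u) (l : ℕ) :
    (frequencies u ((2 * b - 1) * b ^ l + 1)).ncard = (if b = 2 then 2 else 3) ∧
    frequencyBound u (dihedral m) ((2 * b - 1) * b ^ l) = 4 ∧
    ∀ G : Subgroup (Equiv.Perm (List (ZMod m))), IsSymmetryGroup u G →
      4 ≤ frequencyBound u G ((2 * b - 1) * b ^ l) := by
  have hb := hu.ruler.two_le_base
  obtain ⟨ρ, hρ, hfreq⟩ := hu.exists_density
  obtain ⟨w, hw, hrev⟩ := hu.ruler.exists_palindromic_bispecial l
  have hC := hu.ruler.complexity_succ_bispecial l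
  have hpos : 0 < (2 * b - 1) * b ^ l := Nat.mul_pos (by omega) (Nat.pow_pos (by omega))
  have hval : 1 + 2 * ((complexity v ((2 * b - 1) * b ^ l) : ℝ) -
      complexity v ((2 * b - 1) * b ^ l - 1)) -
      (bispecialFactors v ((2 * b - 1) * b ^ l - 1)).ncard = 4 := by
    rw [hC, hw, Set.ncard_singleton]
    push_cast
    ring
  refine ⟨by rw [hu.ncard_frequencies hfreq, hu.ruler.ncard_density_of_modulus_two hρ],
    ?_, fun G hG => ?_⟩
  · have h := hu.frequencyBound_dihedral (n := (2 * b - 1) * b ^ l - 1)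
      (by rw [hw]; rintro _ rfl; exact hrev)
    rwa [Nat.sub_add_cancel hpos, hval] at h
  · have h := hu.le_frequencyBound hG ((2 * b - 1) * b ^ l - 1)
    rwa [Nat.sub_add_cancel hpos, hval] at h

end IsThueMorseLift

end FactorFrequency

theorem mainTheorem5 (b m : ℕ) (hb : 2 ≤ b) (hm : 1 ≤ m) (hbm : ¬ b ≡ 1 [MOD m])
    (q : ℕ) (hq : IsLeast {k : ℕ | 0 < k ∧ k * (b - 1) ≡ 0 [MOD m]} q)
    (u : ℕ → ZMod m) (hu : IsGeneralizedThueMorse b m u) :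
    -- all factor frequencies exist, and the dihedral group is an admissible group for `u`
    (∀ w ∈ language u, ∃ r : ℝ, HasFrequency u w r) ∧
    IsSymmetryGroup u (dihedral m) ∧
    -- for every admissible group, the bound fails to be attained for arbitrarily large `n`
    (∀ G : Subgroup (Equiv.Perm (List (ZMod m))), IsSymmetryGroup u G →
      (∀ M : ℕ, ∃ n ≥ M, ((frequencies u (n + 1)).ncard : ℝ) < frequencyBound u G n) ∧
      -- and it is never attained if `q > 2`
      (2 < q → ∀ n : ℕ, ((frequencies u (n + 1)).ncard : ℝ) < frequencyBound u G n)) ∧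
    (q = 2 → ∀ l : ℕ,
      (frequencies u ((2 * b - 1) * b ^ l + 1)).ncard = (if b = 2 then 2 else 3) ∧
      frequencyBound u (dihedral m) ((2 * b - 1) * b ^ l) = 4) := by
  obtain ⟨κ, v, hlift⟩ := exists_isThueMorseLift hb hm hbm hq hu
  refine ⟨fun w hw => hlift.exists_hasFrequency hw, hlift.isSymmetryGroup_dihedral,
    fun G hG => ⟨fun M => ?_, fun hq2 => hlift.ncard_frequencies_lt hq2 hG⟩, fun hq2 l => ?_⟩
  · rcases hlift.ruler.two_le_modulus.lt_or_eq with hq2 | hq2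
    · exact ⟨M, le_rfl, hlift.ncard_frequencies_lt hq2 hG M⟩
    · subst hq2
      obtain ⟨h1, -, h2⟩ := hlift.frequencies_and_bound_of_modulus_two M
      -- These lengths are unbounded, and at them every admissible group has bound at least $4$,
      -- against at most $3$ frequencies.
      refine ⟨(2 * b - 1) * b ^ M, (Nat.lt_pow_self (by omega)).le.trans
        (Nat.le_mul_of_pos_left _ (by omega)), lt_of_lt_of_le ?_ (h2 G hG)⟩
      rw [h1]
      split_ifs <;> norm_num
  · subst hq2
    obtain ⟨h1, h2, -⟩ := hlift.frequencies_and_bound_of_modulus_two l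
    exact ⟨h1, h2⟩
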